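/- \textbf{Conventions.} A square is identified with its centre; boards of odd side are centred at the origin of $\mathbb Z^2$. A $(p,q)$-leaper moves by vectors $(\pm p,\pm q)$, $(\pm q,\pm p)$; it is skew basic, with $p<q$, if $0<p<q$, $\gcd(p,q)=1$ and $p+q$ is odd. The direction matrices are $$A_1=\begin{pmatrix}0&1\\1&0\end{pmatrix},\ A_2=\begin{pmatrix}1&0\\0&1\end{pmatrix},\ A_3=\begin{pmatrix}-1&0\\0&1\end{pmatrix},\ A_4=\begin{pmatrix}0&-1\\1&0\end{pmatrix},\ A_{i+4}=-A_i\ (i=1,\dots,4),$$ and a move of direction $i$ of a $(p,q)$-leaper with $p<q$ is the move by the vector $A_i\binom pq$. \textbf{Direction graphs.} A direction graph is a symmetric directed graph with arcs labelled by $1,\dots,8$ such that the sum of the direction matrices of the labels over every simple directed cycle (also of length $1$ or $2$) is zero. The distance from $x$ to $y$ in the same component is the sum of the direction matrices over any path from $x$ to $y$. The graph is coherent if, for all $x,y$ in the same component, the distance is $0$ iff $x=y$ and is a direction matrix iff $x$ and $y$ are joined by an arc. A direction graph $\Phi$ is \emph{dual}, of complement $\Phi'$ (a direction graph) and duality matrix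 $A\in\mathbb R^{2\times2}$, if $A$ is not a direction matrix, $\Phi$ and $\Phi'$ are coherent and connected, their underlying unlabelled graphs are isomorphic, and there is a bijection $\eta$ from the vertices of $\Phi$ to those of $\Phi'$ such that for every arc from $\eta(a)$ to $\eta(b)$ labelled $i$ in $\Phi'$ the distance from $a$ to $b$ in $\Phi$ is $A_iA$. The labelled graph extracted from a cycle of a skew leaper has the squares of the cycle as its vertices (up to a bijection), and an arc labelled $i$ from $a$ to $b$ iff $a,b$ are adjacent in the cycle and the move from $a$ to $b$ has direction $i$. \textbf{Frames and liftings.} For $m<n$ with $m+n$ odd, the $(m,n)$-frame is the centred $(m+n)\times(m+n)$ board without its central $(n-m)\times(n-m)$ squares; extending the sides of the hole divides it into eight sections $F_E,F_{NE},F_N,\dots,F_{SE}$. If $3m\ge n$, its shell is the union of eight square subboards, one in each section: of side $n-m$ if $2m\ge n$, and of side $3m-n$ if $2m\le n\le 3m$, with those of $F_E$ and $F_{NE}$ centred at $(n-m,0)$ and $(m,m)$ and the others placed symmetrically under quarter turns. A shell cycle is a cycle of the $(m,n)$-leaper within the shell; it has one square in each section. The liftings $f,g,h$ lift an $(m,n)$-frame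 $F$ to the frame $H$ of proportions $(m,2m+n)$, $(n,2n-m)$, $(n,m+2n)$, respectively. Their translations are given by $v_E=(m+n,0),\ v_{NE}=(m,m)$ for $f$; $v_E=(n-m,0),\ v_{NE}=(n,n)$ for $g$; $v_E=(m+n,0),\ v_{NE}=(n,n)$ for $h$; and $v_N,\dots,v_{SE}$ by quarter turns. A set $S$ of squares of $F$ is lifted to $\bigcup_i\,(S+v_i)\cap H_i$. A cycle $a^Ea^{NE}\cdots a^{SE}$, partitioned into eight paths with $a^i$ in $F_i$, is lifted to $b^Eb^{NE}\cdots b^{SE}$, where (writing $-w$ for the reversal of a path $w$) $$\begin{aligned} f:\quad& b^E=(-a^{SW})(-a^W)(-a^{NW})+v_E,\quad b^{NE}=a^{NE}+v_{NE};\\ g:\quad& b^E=a^E+v_E,\quad b^{NE}=(-a^S)(-a^{SW})(-a^W)+v_{NE};\\ h:\quad& b^E=(-a^S)(-a^{SW})(-a^W)(-a^{NW})(-a^N)+v_E,\quad b^{NE}=a^Ea^{NE}a^N+v_{NE}; \end{aligned}$$ and the other $b^i$ are defined likewise by quarter turns. For a string $e=e_1\cdots e_l$ over $\{f,g,h\}$,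 applying $e$ means applying the liftings $e_l,e_{l-1},\dots,e_1$ in this order. A skew basic $(p,q)$-leaper, $p<q$, has descent $d$ if $d$ lifts a $(1,2)$-frame to a $(p,q)$-frame. \textbf{Fundamental direction cycles.} Let the skew basic $(p,q)$-leaper $L$, $p<q$, have descent $ed$ (the concatenation of $e$ and $d$), and let $C$ be a cycle of $L$ within the $(p+q)\times(p+q)$ board. If the vertex set of $C$ is obtained by applying $e$ to the vertex set of a shell cycle of the frame of descent $d$, then $C$ has descent $e$. The \emph{fundamental direction cycle} $\Phi(e)$ is the labelled graph extracted from a cycle of descent $e$. If moreover $d=od'$ with $o\in\{g,h\}$, let $M$ be the skew basic leaper of descent $d'$; visiting the squares of the shell cycle in the order $E,NE,\dots,SE$ of the sections gives an eight-square cycle of $M$, and lifting this partitioned cycle by $e$ gives a cycle $D$ of $M$ over the squares of $C$, the canonical second leaper cycle of descent $e$ and origin $o$. The \emph{second fundamental direction cycle} $\Phi^{\mathrm{II}}_o(e)$ is the labelled graph extracted from a canonical second leaper cycle of descent $e$ and origin $o$. Let $A_f=\begin{pmatrix}1&0\\2&1\end{pmatrix}$, $A_g=\begin{pmatrix}0&1\\-1&2\end{pmatrix}$,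 $A_h=\begin{pmatrix}0&1\\1&2\end{pmatrix}$ and $A_e=A_{e_1}A_{e_2}\cdots A_{e_l}$ (the identity matrix if $e$ is empty). \textbf{Theorem.} Let $e$ be a (possibly empty) string composed of the characters $f,g,h$, and let $o\in\{g,h\}$. Then cycles of descent $e$, and canonical second leaper cycles of descent $e$ and origin $o$, exist, and for every choice of the cycles from which $\Phi(e)$ and $\Phi^{\mathrm{II}}_o(e)$ are extracted, both $\Phi(e)$ and $\Phi^{\mathrm{II}}_o(e)$ are dual direction graphs. Each of them is a complement of the other, the duality matrix of $\Phi^{\mathrm{II}}_o(e)$ being $A_eA_o$ and that of $\Phi(e)$ being $(A_eA_o)^{-1}$. -/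

import Mathlib

/-- A square of the infinite chessboard, named by its centre. The boards below are
`(p + q) × (p + q)` boards with `p + q` odd; they are centred at the origin, so that the centres
of their squares are integer points. -/
abbrev Square : Type := ℤ × ℤ

/-- The direction matrices `A_1, …, A_8`. The index `i : Fin 8` stands for the skew direction
labelled `i + 1` (`0` is east-northeast, `1` is north-northeast, and so on counterclockwise). -/
def dirMatrix : Fin 8 → Matrix (Fin 2) (Fin 2) ℤ :=
  ![!![0, 1; 1, 0], !![1, 0; 0, 1], !![-1, 0; 0, 1], !![0, -1; 1, 0],
    !![0, -1; -1, 0], !![-1, 0; 0, -1], !![1, 0; 0, -1], !![0, 1; -1, 0]]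

/-- Integer matrices regarded as real matrices. -/
def realMatrix (A : Matrix (Fin 2) (Fin 2) ℤ) : Matrix (Fin 2) (Fin 2) ℝ :=
  A.map (fun z : ℤ => (z : ℝ))

/-! ### Direction graphs -/

/-- A directed graph with vertex set `V` whose arcs are labelled with skew directions:
`Φ.Arc x y i` says that an arc labelled `i` points from `x` to `y`. -/
structure LabeledDigraph (V : Type*) where
  Arc : V → V → Fin 8 → Prop

namespace LabeledDigraph

/-- There is an arc, with some label, from `x` to `y`. -/
def Adj {V : Type*} (Φ : LabeledDigraph V) (x y : V) : Prop := ∃ i, Φ.Arc x y i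

/-- `Φ.Walk x y l A`: there is a directed walk from `x` to `y` which, after its start `x`, visits
the vertices of the list `l` in this order, and on which the direction matrices of the arcs
sum to `A`. -/
inductive Walk {V : Type*} (Φ : LabeledDigraph V) :
    V → V → List V → Matrix (Fin 2) (Fin 2) ℤ → Prop
  | nil (x : V) : Walk Φ x x [] 0
  | cons (x y z : V) (i : Fin 8) (l : List V) (A : Matrix (Fin 2) (Fin 2) ℤ) :
      Φ.Arc x y i → Walk Φ y z l A → Walk Φ x z (y :: l) (dirMatrix i + A)

/-- A direction graph: the directed graph is symmetric, and the direction matrices over every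
simple directed cycle (loops and the 2-cycles `x → y → x` included) sum to zero. So there are
in fact no loops, an arc has only one label, and opposite arcs have opposite labels. -/
def IsDirectionGraph {V : Type*} (Φ : LabeledDigraph V) : Prop :=
  (∀ x y, Φ.Adj x y → Φ.Adj y x) ∧
  ∀ (x : V) (l : List V) (A : Matrix (Fin 2) (Fin 2) ℤ),
    l ≠ [] → l.Nodup → Φ.Walk x x l A → A = 0

/-- `A` is the distance from `x` to `y`: the sum of the direction matrices over a walk from `x`
to `y`. In a direction graph this does not depend on the walk. -/
def HasDist {V : Type*} (Φ : LabeledDigraph V) (x y : V) (A : Matrix (Fin 2) (Fin 2) ℤ) : Prop :=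
  ∃ l, Φ.Walk x y l A

/-- Connectedness (of a symmetric directed graph). -/
def IsConnected {V : Type*} (Φ : LabeledDigraph V) : Prop :=
  Nonempty V ∧ ∀ x y, ∃ A, Φ.HasDist x y A

/-- Coherence: for `x` and `y` in the same component, the distance from `x` to `y` is zero
exactly if `x = y`, and a direction matrix exactly if `x` and `y` are joined by an arc. -/
def IsCoherent {V : Type*} (Φ : LabeledDigraph V) : Prop :=
  ∀ x y A, Φ.HasDist x y A → (A = 0 ↔ x = y) ∧ ((∃ i, A = dirMatrix i) ↔ Φ.Adj x y)

/-- `Φ` is a dual direction graph of complement `Φ'` and duality matrix `M`. -/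
def IsDualWith {V V' : Type*} (Φ : LabeledDigraph V) (Φ' : LabeledDigraph V')
    (M : Matrix (Fin 2) (Fin 2) ℝ) : Prop :=
  Φ.IsDirectionGraph ∧ Φ'.IsDirectionGraph ∧
  (∀ i, M ≠ realMatrix (dirMatrix i)) ∧
  (Φ.IsCoherent ∧ Φ.IsConnected) ∧ (Φ'.IsCoherent ∧ Φ'.IsConnected) ∧
  (∃ φ : V ≃ V', ∀ x y, Φ.Adj x y ↔ Φ'.Adj (φ x) (φ y)) ∧
  ∃ η : V ≃ V', ∀ a b i, Φ'.Arc (η a) (η b) i →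
    ∃ A, Φ.HasDist a b A ∧ realMatrix A = realMatrix (dirMatrix i) * M

/-- `Φ` is a dual direction graph. -/
def IsDual.{u} {V : Type u} (Φ : LabeledDigraph V) : Prop :=
  ∃ (V' : Type u) (Φ' : LabeledDigraph V') (M : Matrix (Fin 2) (Fin 2) ℝ), Φ.IsDualWith Φ' M

end LabeledDigraph

/-! ### Leapers and their cycles -/

/-- A `(p, q)`-leaper with `p < q` that is skew and basic. -/
def IsSkewBasic (p q : ℤ) : Prop := 0 < p ∧ p < q ∧ Odd (p + q) ∧ IsCoprime p q

/-- A move of direction `i` of a `(p, q)`-leaper leads from `a` to `b`. -/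
def MoveDir (p q : ℤ) (i : Fin 8) (a b : Square) : Prop :=
  ![b.1 - a.1, b.2 - a.2] = (dirMatrix i).mulVec ![p, q]

/-- `b` follows `a` in the cyclic sequence `l`. -/
def Follows (l : List Square) (a b : Square) : Prop := ∃ t, l ~r (a :: b :: t)

/-- The cyclic sequence `l` is a (simple) cycle of a `(p, q)`-leaper. -/
def IsLeaperCycle (p q : ℤ) (l : List Square) : Prop :=
  l.Nodup ∧ 3 ≤ l.length ∧ ∀ a b, Follows l a b → ∃ i, MoveDir p q i a b

/-- The vertex set of a cycle. -/
def vertexSet (l : List Square) : Set Square := {a | a ∈ l}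

/-- The labelled directed graph `Φ` is extracted from the cycle `l` of a `(p, q)`-leaper: for a
suitable bijection `σ` of the vertices, an arc labelled `i` points from `σ a` to `σ b` if and only
if `a` and `b` are adjacent in the cycle and the move from `a` to `b` has direction `i`. -/
def IsExtractedFrom {V : Type*} (Φ : LabeledDigraph V) (p q : ℤ) (l : List Square) : Prop :=
  ∃ σ : {a // a ∈ l} ≃ V, ∀ (a b : {a // a ∈ l}) (i : Fin 8),
    Φ.Arc (σ a) (σ b) i ↔
      (Follows l a.1 b.1 ∨ Follows l b.1 a.1) ∧ MoveDir p q i a.1 b.1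

/-! ### Frames, shells and liftings -/

/-- The `(p + q) × (p + q)` chessboard. -/
def board (p q : ℤ) : Set Square := {a | 2 * |a.1| < p + q ∧ 2 * |a.2| < p + q}

/-- Eight vectors pointing east, northeast, …, southeast (indices `0, 1, …, 7`), where the side
directions have length `a` and the corner directions have both coordinates `± b`. -/
def octVec (a b : ℤ) : Fin 8 → ℤ × ℤ :=
  ![(a, 0), (b, b), (0, a), (-b, b), (-a, 0), (-b, -b), (0, -a), (b, -b)]

/-- The coordinate `x` of a square of an `(m, n)`-frame is level with the central hole (`s = 0`)
or between the hole and the outer contour, on the side of sign `s` (`s = 1` or `s = -1`). -/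
def InBand (m n s x : ℤ) : Prop :=
  if s = 0 then 2 * |x| < n - m else n - m < 2 * (s * x) ∧ 2 * (s * x) < m + n

/-- The section of the `(m, n)`-frame in the direction `i` (east, northeast, …, southeast).
The frame is the disjoint union of its eight sections. -/
def frameSection (m n : ℤ) (i : Fin 8) : Set Square :=
  {a | InBand m n (octVec 1 1 i).1 a.1 ∧ InBand m n (octVec 1 1 i).2 a.2}

/-- The shell of the `(m, n)`-frame, `n ≤ 3 * m`. If `n ≤ 2 * m`, it consists of the eight
subboards of side `n - m` in the corners and next to the sides of the hole. If
`2 * m ≤ n ≤ 3 * m`, it consists of the eight subboards of side `3 * m - n` in the middle of the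
outer sides and touching the hole at its corners. In both cases the subboards of the east and the
northeast sections are centred at `(n - m, 0)` and `(m, m)`. (If `3 * m < n`, there is no shell,
and this is the empty set.) -/
def shell (m n : ℤ) : Set Square :=
  {a | ∃ i : Fin 8,
    2 * |a.1 - (octVec (n - m) m i).1| < (if n ≤ 2 * m then n - m else 3 * m - n) ∧
    2 * |a.2 - (octVec (n - m) m i).2| < (if n ≤ 2 * m then n - m else 3 * m - n)}

/-- A shell cycle of the `(m, n)`-frame: a cycle of the `(m, n)`-leaper within the shell. -/
def IsShellCycle (m n : ℤ) (C : List Square) : Prop :=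
  IsLeaperCycle m n C ∧ vertexSet C ⊆ shell m n

/-- The three types of lifting transformations. -/
inductive Lifting : Type
  | f
  | g
  | h

namespace Lifting

/-- An `(m, n)`-frame is lifted to an `(m, 2m + n)`-, `(n, 2n - m)`- or `(n, m + 2n)`-frame. -/
def frame : Lifting → ℤ × ℤ → ℤ × ℤ
  | f, (m, n) => (m, 2 * m + n)
  | g, (m, n) => (n, 2 * n - m)
  | h, (m, n) => (n, m + 2 * n)

/-- The `f`-, `g`- or `h`-translation of an `(m, n)`-frame in the direction `i`. -/
def translation : Lifting → ℤ × ℤ → Fin 8 → ℤ × ℤ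
  | f, (m, n) => octVec (m + n) m
  | g, (m, n) => octVec (n - m) n
  | h, (m, n) => octVec (m + n) n

/-- The lift of a set `S` of squares of the frame `F = (m, n)`: the union over all directions `i`
of the sets `(S + v_i) ∩ H_i`, where `H` is the lifted frame. -/
def liftSet (c : Lifting) (F : ℤ × ℤ) (S : Set Square) : Set Square :=
  {b | ∃ i : Fin 8, b ∈ frameSection (c.frame F).1 (c.frame F).2 i ∧ b - c.translation F i ∈ S}

/-- The lift of a cycle `a 0, a 1, …, a 7` (that is, `a^E, a^NE, …, a^SE`) partitioned into eight
paths, one in each section of the frame `F`. Each new path is a concatenation of old paths,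
reversed or not, translated by `v_i`:

* `f`: `b^E = -a^SW -a^W -a^NW + v_E` and `b^NE = a^NE + v_NE`,
* `g`: `b^E = a^E + v_E` and `b^NE = -a^S -a^SW -a^W + v_NE`,
* `h`: `b^E = -a^S -a^SW -a^W -a^NW -a^N + v_E` and `b^NE = a^E a^NE a^N + v_NE`,

and symmetrically under quarter turns. -/
def liftPaths (c : Lifting) (F : ℤ × ℤ) (a : Fin 8 → List Square) : Fin 8 → List Square :=
  fun i =>
    (match c, decide (i.val % 2 = 0) with
      | f, true => (a (i + 5)).reverse ++ (a (i + 4)).reverse ++ (a (i + 3)).reverse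
      | f, false => a i
      | g, true => a i
      | g, false => (a (i + 5)).reverse ++ (a (i + 4)).reverse ++ (a (i + 3)).reverse
      | h, true => (a (i + 6)).reverse ++ (a (i + 5)).reverse ++ (a (i + 4)).reverse ++
          (a (i + 3)).reverse ++ (a (i + 2)).reverse
      | h, false => a (i - 1) ++ a i ++ a (i + 1)).map (fun s => s + c.translation F i)

/-- The matrices `A_f`, `A_g`, `A_h`. -/
def matrix : Lifting → Matrix (Fin 2) (Fin 2) ℤ
  | f => !![1, 0; 2, 1]
  | g => !![0, 1; -1, 2]
  | h => !![0, 1; 1, 2]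

end Lifting

/-- The proportions of the frame obtained from a `(1, 2)`-frame by successively applying the
liftings of types `e_l, …, e_1`, where `e = e_1 … e_l`; that is, the proportions of the
skew basic leaper of descent `e`. -/
def proportions : List Lifting → ℤ × ℤ
  | [] => (1, 2)
  | c :: e => c.frame (proportions e)

/-- Starting from a set of squares of the frame of descent `d`, successively apply the liftings
of types `e_l, …, e_1`, where `e = e_1 … e_l`. -/
def liftSets (d : List Lifting) : List Lifting → Set Square → Set Square
  | [], S => S
  | c :: e, S => c.liftSet (proportions (e ++ d)) (liftSets d e S)

/-- Starting from a partitioned cycle in the frame of descent `d`, successively apply the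
liftings of types `e_l, …, e_1`, where `e = e_1 … e_l`. -/
def liftCycles (d : List Lifting) : List Lifting → (Fin 8 → List Square) → (Fin 8 → List Square)
  | [], a => a
  | c :: e, a => c.liftPaths (proportions (e ++ d)) (liftCycles d e a)

/-- The matrix `A_e = A_{e_1} ⋯ A_{e_l}`. -/
def wordMatrix (e : List Lifting) : Matrix (Fin 2) (Fin 2) ℤ := (e.map Lifting.matrix).prod

/-! ### The two fundamental direction cycles -/

/-- `C` is a cycle of a `(p, q)`-leaper within a `(p + q) × (p + q)` chessboard. -/
def IsBoardCycle (p q : ℤ) (C : List Square) : Prop :=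
  IsLeaperCycle p q C ∧ vertexSet C ⊆ board p q

/-- `e` is the descent of the cycle `C` of the skew basic `(p, q)`-leaper: it is a prefix of the
descent `e ++ d` of the leaper, and `C` is obtained from a shell cycle of the frame of descent `d`
by the liftings of `e`. -/
def HasDescent (p q : ℤ) (C : List Square) (e : List Lifting) : Prop :=
  ∃ d : List Lifting, proportions (e ++ d) = (p, q) ∧
    ∃ C₀, IsShellCycle (proportions d).1 (proportions d).2 C₀ ∧
      vertexSet C = liftSets d e (vertexSet C₀)

/-- `D` is the canonical second leaper cycle, of descent `e` and origin `o`, of an `(r, s)`-leaper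
over the squares of the cycle `C` of the skew basic `(p, q)`-leaper. Here `e ++ o :: d` is the
descent of the `(p, q)`-leaper and `d` that of the `(r, s)`-leaper. One starts from a shell cycle
`C₀` of the frame of descent `o :: d`, which has one square in each of the eight sections; the
second leaper visits these squares in the order of the sections; and this cycle is lifted. -/
def IsCanonicalSecondCycle (p q : ℤ) (C : List Square) (r s : ℤ) (D : List Square)
    (e : List Lifting) (o : Lifting) : Prop :=
  ∃ d : List Lifting, proportions (e ++ o :: d) = (p, q) ∧ proportions d = (r, s) ∧
    ∃ (C₀ : List Square) (a₀ : Fin 8 → List Square),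
      IsShellCycle (proportions (o :: d)).1 (proportions (o :: d)).2 C₀ ∧
      (∀ i, ∃ x ∈ frameSection (proportions (o :: d)).1 (proportions (o :: d)).2 i,
        a₀ i = [x]) ∧
      vertexSet (List.ofFn a₀).flatten = vertexSet C₀ ∧
      D = (List.ofFn (liftCycles (o :: d) e a₀)).flatten ∧
      vertexSet D = vertexSet C

/-- `Φ` is the fundamental direction cycle `Φ(e)` of descent `e`: it is extracted from a cycle of
descent `e` of a skew basic `(p, q)`-leaper within a `(p + q) × (p + q)` chessboard. -/
def IsFundamentalCycle {V : Type*} (e : List Lifting) (Φ : LabeledDigraph V) : Prop :=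
  ∃ (p q : ℤ) (C : List Square), IsSkewBasic p q ∧ IsBoardCycle p q C ∧ HasDescent p q C e ∧
    IsExtractedFrom Φ p q C

/-- `Φ` is the second fundamental direction cycle of descent `e` and origin `o`: it is extracted
from a canonical second leaper cycle of descent `e` and origin `o`, over the squares of a cycle of
a skew basic `(p, q)`-leaper within a `(p + q) × (p + q)` chessboard. -/
def IsSecondFundamentalCycle {V : Type*} (e : List Lifting) (o : Lifting)
    (Φ : LabeledDigraph V) : Prop :=
  ∃ (p q : ℤ) (C : List Square) (r s : ℤ) (D : List Square),
    IsSkewBasic p q ∧ IsBoardCycle p q C ∧ IsSkewBasic r s ∧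
    IsCanonicalSecondCycle p q C r s D e o ∧ IsExtractedFrom Φ r s D

universe u

/-!
Every square of a cycle of descent `e` has the form `P (m, n) + t`, where `(m, n)` are the
proportions of the frame which contains the shell cycle, `t` is the offset of the squares of the
shell cycle in the subboards of the shell, and the integer matrix `P` depends only on `e` and on
the place of the square in the cycle. All cycles of descent `e` thus share one set of formal squares
`P`. The vectors of the moves become matrices as well: `A_k A_e` for the first leaper and
`A_k A_o⁻¹` for the second one, whose set does not depend on `o` because `A_g⁻¹ A_h` is a direction
matrix. Hence distances in `Φ(e)` and `Φᴵᴵ(e)` are differences of the same formal squares, scaled by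
`A_e⁻¹` and by `A_o` respectively, and the duality can be read off once all moves between formal
squares are known to be arcs.

For the first leaper, only the moves of directions `i + 3` and `i + 4` lead from the `i`-th section
to squares of the board, so every move on the board is one of the two moves along the cycle. For the
second leaper, the specialisation `(m, n) = (1, 2)`, `t = 0` turns its moves into steps to squares
with a common side, and an induction on `e` shows that squares of the cycle with a common side are
adjacent in the cycle.
-/

/-! ### Cyclic sequences -/

/-- `b` follows `a` in the cyclic sequence `l`: the relation `Follows` for entries of any type. -/
def CycNext {α : Type*} (l : List α) (a b : α) : Prop := ∃ t, l ~r (a :: b :: t)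

/-- `a` and `b` are adjacent in the cyclic sequence `l`. -/
def CycAdj {α : Type*} (l : List α) (a b : α) : Prop := CycNext l a b ∨ CycNext l b a

section CyclicSequences

variable {α β : Type*} {l : List α} {a b : α}

theorem CycNext.mem_left (h : CycNext l a b) : a ∈ l := by
  obtain ⟨t, h⟩ := h
  simp [h.mem_iff]

theorem CycNext.mem_right (h : CycNext l a b) : b ∈ l := by
  obtain ⟨t, h⟩ := h
  simp [h.mem_iff]

theorem CycNext.map (f : α → β) (h : CycNext l a b) : CycNext (l.map f) (f a) (f b) := by
  obtain ⟨t, h⟩ := h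
  exact ⟨t.map f, h.map f⟩

theorem CycNext.of_map {f : α → β} {x y : β} (h : CycNext (l.map f) x y) :
    ∃ a b, f a = x ∧ f b = y ∧ CycNext l a b := by
  obtain ⟨t, n, h⟩ := h
  rw [← List.map_rotate, List.map_eq_cons_iff] at h
  obtain ⟨a, l', h, rfl, h'⟩ := h
  obtain ⟨b, t, rfl, rfl, -⟩ := List.map_eq_cons_iff.1 h'
  exact ⟨a, b, rfl, rfl, t, n, h⟩

theorem CycNext.right_unique (hl : l.Nodup) {b' : α} (h : CycNext l a b)
    (h' : CycNext l a b') : b = b' := by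
  classical
  have next_eq : ∀ {c}, CycNext l a c → l.next a h.mem_left = c := by
    rintro c ⟨t, ht⟩
    rw [List.isRotated_next_eq ht hl, List.next_cons_cons_eq]
  exact (next_eq h).symm.trans (next_eq h')

theorem CycNext.rel_of_chain {R : α → α → Prop} (hl : Cycle.Chain R (l : Cycle α))
    (h : CycNext l a b) : R a b := by
  obtain ⟨t, h⟩ := h
  rw [Cycle.coe_eq_coe.2 h, Cycle.chain_coe_cons] at hl
  exact hl.rel

theorem CycAdj.symm (h : CycAdj l a b) : CycAdj l b a := Or.symm h

theorem CycAdj.mem_right (h : CycAdj l a b) : b ∈ l :=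
  h.elim CycNext.mem_right CycNext.mem_left

theorem CycAdj.map (f : α → β) (h : CycAdj l a b) : CycAdj (l.map f) (f a) (f b) :=
  h.imp (CycNext.map f) (CycNext.map f)

theorem exists_isRotated_cons (ha : a ∈ l) : ∃ t, l ~r (a :: t) := by
  obtain ⟨s, t, rfl⟩ := List.append_of_mem ha
  exact ⟨t ++ s, List.isRotated_append⟩

theorem forall_mem_of_cycNext {p : α → Prop} (ha : a ∈ l) (hpa : p a)
    (hp : ∀ x y, CycNext l x y → p x → p y) : ∀ b ∈ l, p b := by
  obtain ⟨t, ht⟩ := exists_isRotated_cons ha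
  have forall_mem_prefix : ∀ (s : List α) (t : List α) (a : α), p a → l ~r (a :: (s ++ t)) →
      ∀ b ∈ s, p b := by
    intro s
    induction s with
    | nil => simp
    | cons c s ih =>
      intro t a hpa hr
      have hpc : p c := hp a c ⟨_, hr⟩ hpa
      refine List.forall_mem_cons.2 ⟨hpc, ih (t ++ [a]) c hpc (hr.trans ?_)⟩
      rw [← List.append_assoc]
      exact List.isRotated_append (l := [a]) (l' := c :: (s ++ t))
  intro b hb
  rcases List.mem_cons.1 (ht.mem_iff.1 hb) with rfl | hb
  exacts [hpa, forall_mem_prefix t [] a hpa (by simpa using ht) b hb]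

theorem exists_cycAdj_ne (hl : l.Nodup) (h3 : 3 ≤ l.length) (ha : a ∈ l) :
    ∃ b c, CycAdj l a b ∧ CycAdj l a c ∧ b ≠ c := by
  obtain ⟨t, ht⟩ := exists_isRotated_cons ha
  have hlen := ht.perm.length_eq
  have hnd := (ht.nodup_iff).1 hl
  obtain _ | ⟨b, t⟩ := t
  · simp only [List.length_cons, List.length_nil] at hlen; omega
  rcases t.eq_nil_or_concat with rfl | ⟨t, c, rfl⟩
  · simp only [List.length_cons, List.length_nil] at hlen; omega
  refine ⟨b, c, .inl ⟨_, ht⟩, .inr ⟨b :: t, ht.trans ?_⟩, ?_⟩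
  · simpa using List.isRotated_append (l := a :: b :: t) (l' := [c])
  · rintro rfl
    simp at hnd

theorem isRotated_ofFn_add {n : ℕ} (f : Fin (n + 1) → α) (i : Fin (n + 1)) :
    List.ofFn f ~r List.ofFn fun j => f (i + j) := by
  refine ⟨i, List.ext_getElem (by simp) fun k h₁ h₂ => ?_⟩
  simp only [List.getElem_rotate, List.getElem_ofFn, List.length_ofFn]
  congr 1
  ext
  simp [Fin.val_add, Nat.add_comm]

theorem cycNext_ofFn {n : ℕ} (f : Fin (n + 2) → α) (i : Fin (n + 2)) :
    CycNext (List.ofFn f) (f i) (f (i + 1)) := by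
  have hcons : List.ofFn (fun j => f (i + j)) =
      f i :: f (i + 1) :: List.ofFn fun j : Fin n => f (i + j.succ.succ) := by
    rw [List.ofFn_succ, List.ofFn_succ, add_zero, Fin.succ_zero_eq_one']
  exact ⟨_, hcons ▸ isRotated_ofFn_add f i⟩

theorem CycNext.exists_of_ofFn {n : ℕ} {f : Fin (n + 2) → α} (h : CycNext (List.ofFn f) a b) :
    ∃ i, f i = a ∧ f (i + 1) = b := by
  rw [List.ofFn_eq_map] at h
  obtain ⟨i, j, rfl, rfl, hij⟩ := h.of_map
  rw [← List.ofFn_id] at hij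
  exact ⟨i, rfl, congrArg f (CycNext.right_unique
    (List.nodup_ofFn.2 Function.injective_id) (cycNext_ofFn id i) hij)⟩

theorem cycAdj_ofFn_iff {n : ℕ} {f : Fin (n + 2) → α} (hf : Function.Injective f)
    {i j : Fin (n + 2)} :
    CycAdj (List.ofFn f) (f i) (f j) ↔ (SimpleGraph.cycleGraph (n + 2)).Adj i j := by
  have cycNext_iff : ∀ i j, CycNext (List.ofFn f) (f i) (f j) ↔ j - i = 1 := fun i j => by
    rw [sub_eq_iff_eq_add']
    constructor
    · intro h
      obtain ⟨k, hk, hk'⟩ := h.exists_of_ofFn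
      rw [← hf hk, ← hf hk']
    · rintro rfl
      exact cycNext_ofFn f i
  rw [SimpleGraph.cycleGraph_adj, CycAdj, cycNext_iff, cycNext_iff, or_comm]

theorem exists_equiv_cycleGraph {n : ℕ} (hl : l.Nodup) (hn : l.length = n) (h2 : 2 ≤ n) :
    ∃ φ : Fin n ≃ {a // a ∈ l}, ∀ i j,
      CycAdj l (φ i).1 (φ j).1 ↔ (SimpleGraph.cycleGraph n).Adj i j := by
  obtain ⟨f, rfl⟩ : ∃ f : Fin n → α, List.ofFn f = l := by
    subst hn
    exact ⟨l.get, List.ofFn_get l⟩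
  have hf : Function.Injective f := List.nodup_ofFn.1 hl
  let φ : Fin n → {a // a ∈ List.ofFn f} := fun i => ⟨f i, List.mem_ofFn.2 ⟨i, rfl⟩⟩
  have hφ : Function.Bijective φ := by
    refine ⟨fun i j h => hf (Subtype.ext_iff.1 h), fun ⟨a, ha⟩ => ?_⟩
    obtain ⟨i, rfl⟩ := List.mem_ofFn.1 ha
    exact ⟨i, rfl⟩
  obtain ⟨m, rfl⟩ := Nat.exists_eq_add_of_le' h2
  exact ⟨Equiv.ofBijective φ hφ, fun i j => cycAdj_ofFn_iff hf⟩

theorem isRotated_flatten {L L' : List (List α)} (h : L ~r L') : L.flatten ~r L'.flatten := by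
  obtain ⟨n, rfl⟩ := h
  rw [List.rotate_eq_drop_append_take_mod, List.flatten_append]
  nth_rw 1 [← List.take_append_drop (n % L.length) L]
  rw [List.flatten_append]
  exact List.isRotated_append

theorem CycNext.flatten_of_infix {L : List (List α)} (hl : l ∈ L) (h : [a, b] <:+: l) :
    CycNext L.flatten a b := by
  obtain ⟨s, t, rfl⟩ := h
  obtain ⟨L', hr⟩ := exists_isRotated_cons hl
  have hr := isRotated_flatten hr
  rw [List.flatten_cons, List.append_assoc, List.append_assoc] at hr
  exact ⟨_, hr.trans List.isRotated_append⟩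

theorem CycNext.flatten_of_junction {L : List (List α)} {l' : List α} (h : CycNext L l l')
    (ha : a ∈ l.getLast?) (hb : b ∈ l'.head?) : CycNext L.flatten a b := by
  obtain ⟨L', hr⟩ := h
  have hr := isRotated_flatten hr
  rw [List.flatten_cons, List.flatten_cons, ← List.dropLast_append_getLast? a ha,
    ← List.cons_head?_tail hb, List.append_assoc] at hr
  exact ⟨_, hr.trans List.isRotated_append⟩

theorem CycNext.flatten_cases {n : ℕ} {p : Fin (n + 2) → List α} (hne : ∀ i, p i ≠ [])
    (hnd : (List.ofFn p).flatten.Nodup) (h : CycNext (List.ofFn p).flatten a b) :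
    (∃ i, [a, b] <:+: p i) ∨ ∃ i, a ∈ (p i).getLast? ∧ b ∈ (p (i + 1)).head? := by
  obtain ⟨l, hl, hal⟩ := List.mem_flatten.1 h.mem_left
  obtain ⟨i, rfl⟩ := List.mem_ofFn.1 hl
  obtain ⟨s, t, hst⟩ := List.append_of_mem hal
  rcases t with _ | ⟨c, t⟩
  · have hlast : a ∈ (p i).getLast? := by simp [hst]
    have hhead : (p (i + 1)).head (hne _) ∈ (p (i + 1)).head? := List.head_mem_head? _
    obtain rfl := h.right_unique hnd (flatten_of_junction (cycNext_ofFn p i) hlast hhead)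
    exact .inr ⟨i, hlast, hhead⟩
  · have hinfix : [a, c] <:+: p i := ⟨s, t, by simp [hst]⟩
    obtain rfl := h.right_unique hnd (flatten_of_infix hl hinfix)
    exact .inl ⟨i, hinfix⟩

end CyclicSequences

theorem exists_hamiltonian_cycle {V : Type*} [Finite V] [Nonempty V] {G : SimpleGraph V}
    (h2 : ∀ v, (G.neighborSet v).ncard = 2) (hG : G.Preconnected) :
    ∃ l : List V, l.Nodup ∧ 3 ≤ l.length ∧ (∀ v, v ∈ l) ∧ ∀ v w, CycNext l v w → G.Adj v w := by
  obtain ⟨v⟩ := ‹Nonempty V›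
  have hn : (G.neighborSet v).Nonempty :=
    Set.nonempty_of_ncard_ne_zero (by rw [h2]; exact two_ne_zero)
  have hcyc : G.IsCycles := fun v _ => h2 v
  obtain ⟨p, hp, hverts⟩ := hcyc.exists_cycle_toSubgraph_verts_eq_connectedComponentSupp
    (c := G.connectedComponentMk v) (v := v) rfl hn
  have h3 := hp.three_le_length
  obtain ⟨l, hl⟩ : ∃ l, p.support.tail = l ++ [v] := by
    have htail : p.support.tail ≠ [] := by simp [← List.length_pos_iff]; omega
    refine ⟨p.support.tail.dropLast, ?_⟩
    conv_lhs => rw [← List.dropLast_append_getLast htail]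
    rw [List.getLast_tail, SimpleGraph.Walk.getLast_support]
  have hsupport : p.support = v :: (l ++ [v]) := by
    rw [← hl, SimpleGraph.Walk.cons_tail_support]
  have hlen := congrArg List.length hl
  rw [List.length_tail, SimpleGraph.Walk.length_support, List.length_append] at hlen
  refine ⟨v :: l, ?_, ?_, fun w => ?_, fun a b => CycNext.rel_of_chain ?_⟩
  · have := hp.support_nodup
    rw [hl] at this
    exact (List.perm_append_comm (l₁ := [v])).nodup_iff.2 this
  · simp only [List.length_cons, List.length_nil] at hlen ⊢; omega
  · have hw : w ∈ p.support := by
      rw [← SimpleGraph.Walk.mem_verts_toSubgraph, hverts]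
      exact SimpleGraph.ConnectedComponent.sound (hG w v)
    rw [hsupport] at hw
    simpa [or_comm] using hw
  · rw [Cycle.chain_coe_cons, ← hsupport]
    exact p.isChain_adj_support

/-! ### Moves of leapers -/

/-- The vector obtained by applying the matrix `M` to the vector `x`. -/
def act (M : Matrix (Fin 2) (Fin 2) ℤ) (x : ℤ × ℤ) : ℤ × ℤ :=
  (M 0 0 * x.1 + M 0 1 * x.2, M 1 0 * x.1 + M 1 1 * x.2)

section Moves

variable {p q : ℤ} {i j k : Fin 8} {a b c t : Square}

theorem act_add (M N : Matrix (Fin 2) (Fin 2) ℤ) (x : ℤ × ℤ) :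
    act (M + N) x = act M x + act N x := by
  ext <;> (simp [act]; ring)

theorem act_neg (M : Matrix (Fin 2) (Fin 2) ℤ) (x : ℤ × ℤ) : act (-M) x = -act M x := by
  ext <;> (simp [act]; ring)

theorem act_sub (M N : Matrix (Fin 2) (Fin 2) ℤ) (x : ℤ × ℤ) :
    act (M - N) x = act M x - act N x := by
  rw [sub_eq_add_neg, act_add, act_neg, sub_eq_add_neg]

theorem act_mul (M N : Matrix (Fin 2) (Fin 2) ℤ) (x : ℤ × ℤ) :
    act (M * N) x = act M (act N x) := by
  ext <;> (simp [act, Matrix.mul_apply, Fin.sum_univ_two]; ring)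

theorem act_one (x : ℤ × ℤ) : act 1 x = x := by
  ext <;> simp [act]

theorem dirMatrix_injective : Function.Injective dirMatrix := by
  unfold Function.Injective
  decide

theorem dirMatrix_add_four : ∀ i, dirMatrix (i + 4) = -dirMatrix i := by decide

theorem exists_dirMatrix_mul_eq_one : ∀ i, ∃ j, dirMatrix i * dirMatrix j = 1 := by decide

theorem moveDir_iff : MoveDir p q k a b ↔ b = a + act (dirMatrix k) (p, q) := by
  unfold MoveDir
  rw [← List.ofFn_inj]
  simp [Matrix.mulVec, dotProduct, Fin.sum_univ_two, Prod.ext_iff, act, sub_eq_iff_eq_add']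

theorem MoveDir.symm (h : MoveDir p q k a b) : MoveDir p q (k + 4) b a := by
  rw [moveDir_iff] at *
  rw [dirMatrix_add_four, act_neg, h, add_neg_cancel_right]

theorem MoveDir.add_right (h : MoveDir p q k a b) (t : Square) :
    MoveDir p q k (a + t) (b + t) := by
  rw [moveDir_iff] at *
  rw [h, add_right_comm]

theorem MoveDir.right_unique (h : MoveDir p q k a b) (h' : MoveDir p q k a c) : b = c :=
  (moveDir_iff.1 h).trans (moveDir_iff.1 h').symm

theorem MoveDir.dir_unique (hp : 0 < p) (hpq : p < q) (h : MoveDir p q i a b)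
    (h' : MoveDir p q j a b) : i = j := by
  have hij := add_left_cancel ((moveDir_iff.1 h).symm.trans (moveDir_iff.1 h'))
  simp only [act, Prod.mk.injEq] at hij
  clear h h'
  revert hij
  fin_cases i <;> fin_cases j <;> simp [dirMatrix] <;> omega

end Moves

/-! ### Graphs extracted from leaper cycles -/

theorem realMatrix_mul (A B : Matrix (Fin 2) (Fin 2) ℤ) :
    realMatrix (A * B) = realMatrix A * realMatrix B :=
  Matrix.map_mul (f := Int.castRingHom ℝ)

theorem realMatrix_one : realMatrix 1 = 1 :=
  Matrix.map_one (fun z : ℤ => (z : ℝ)) Int.cast_zero Int.cast_one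

theorem realMatrix_injective : Function.Injective realMatrix :=
  Matrix.map_injective Int.cast_injective

theorem exists_realMatrix_dirMatrix_inv (i : Fin 8) :
    ∃ j, (realMatrix (dirMatrix i))⁻¹ = realMatrix (dirMatrix j) := by
  obtain ⟨j, hij⟩ := exists_dirMatrix_mul_eq_one i
  exact ⟨j, Matrix.inv_eq_right_inv (by rw [← realMatrix_mul, hij, realMatrix_one])⟩

namespace LabeledDigraph

/-- The vertices of `Φ` have distinct positions such that an arc labelled `i` points from `x` to
`y` exactly if the difference of their positions, multiplied by `U`, is `dirMatrix i`. -/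
structure IsPositioned {V : Type*} (Φ : LabeledDigraph V)
    (pos : V → Matrix (Fin 2) (Fin 2) ℤ) (U : Matrix (Fin 2) (Fin 2) ℤ) : Prop where
  injective : Function.Injective pos
  isUnit : IsUnit U
  arc_iff : ∀ x y i, Φ.Arc x y i ↔ (pos y - pos x) * U = dirMatrix i

/-- The underlying unlabelled graph of `Φ` is a cycle graph. -/
def IsCycleGraph {V : Type*} (Φ : LabeledDigraph V) : Prop :=
  ∃ (n : ℕ) (σ : Fin (n + 1) ≃ V), ∀ i j,
    Φ.Adj (σ i) (σ j) ↔ (SimpleGraph.cycleGraph (n + 1)).Adj i j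

variable {V W : Type*} {Φ : LabeledDigraph V} {Ψ : LabeledDigraph W}
  {pos : V → Matrix (Fin 2) (Fin 2) ℤ} {pos' : W → Matrix (Fin 2) (Fin 2) ℤ}
  {U U' : Matrix (Fin 2) (Fin 2) ℤ}

theorem IsPositioned.walk_sum (h : Φ.IsPositioned pos U) {x y : V} {l : List V}
    {A : Matrix (Fin 2) (Fin 2) ℤ} (hw : Φ.Walk x y l A) : A = (pos y - pos x) * U := by
  induction hw with
  | nil x => simp
  | cons x y z i l A ha _ ih =>
    rw [← (h.arc_iff x y i).1 ha, ih, ← Matrix.add_mul, sub_add_sub_cancel']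

theorem IsPositioned.adj_symm (h : Φ.IsPositioned pos U) {x y : V} (hxy : Φ.Adj x y) :
    Φ.Adj y x := by
  obtain ⟨i, hi⟩ := hxy
  refine ⟨i + 4, (h.arc_iff _ _ _).2 ?_⟩
  rw [dirMatrix_add_four, ← (h.arc_iff _ _ _).1 hi, ← Matrix.neg_mul, neg_sub]

theorem IsPositioned.isDirectionGraph (h : Φ.IsPositioned pos U) : Φ.IsDirectionGraph :=
  ⟨fun _ _ => h.adj_symm, fun x l A _ _ hw => by simp [h.walk_sum hw]⟩

theorem IsPositioned.isCoherent (h : Φ.IsPositioned pos U) : Φ.IsCoherent := by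
  rintro x y A ⟨l, hw⟩
  rw [h.walk_sum hw, h.isUnit.mul_left_eq_zero, sub_eq_zero, h.injective.eq_iff, eq_comm]
  exact ⟨Iff.rfl, exists_congr fun i => (h.arc_iff x y i).symm⟩

theorem exists_hasDist_of_reflTransGen {x y : V} (h : Relation.ReflTransGen Φ.Adj x y) :
    ∃ A, Φ.HasDist x y A := by
  induction h using Relation.ReflTransGen.head_induction_on with
  | refl => exact ⟨0, [], .nil _⟩
  | head hxz _ ih =>
    obtain ⟨i, hi⟩ := hxz
    obtain ⟨A, l, hl⟩ := ih
    exact ⟨_, _, .cons _ _ _ _ _ _ hi hl⟩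

theorem IsCycleGraph.isConnected (h : Φ.IsCycleGraph) : Φ.IsConnected := by
  obtain ⟨n, σ, hσ⟩ := h
  refine ⟨⟨σ 0⟩, fun x y => exists_hasDist_of_reflTransGen ?_⟩
  obtain ⟨i, rfl⟩ := σ.surjective x
  obtain ⟨j, rfl⟩ := σ.surjective y
  have hij := SimpleGraph.cycleGraph_preconnected i j
  rw [SimpleGraph.reachable_iff_reflTransGen] at hij
  exact hij.lift σ fun i j => (hσ i j).2

theorem IsCycleGraph.exists_iso (h : Φ.IsCycleGraph) (h' : Ψ.IsCycleGraph) (η : V ≃ W) :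
    ∃ φ : V ≃ W, ∀ x y, Φ.Adj x y ↔ Ψ.Adj (φ x) (φ y) := by
  obtain ⟨m, σ, hσ⟩ := h
  obtain ⟨n, τ, hτ⟩ := h'
  obtain rfl : m = n := by
    simpa using Fintype.card_congr ((σ.trans η).trans τ.symm)
  refine ⟨σ.symm.trans τ, fun x y => ?_⟩
  rw [Equiv.trans_apply, Equiv.trans_apply, hτ, ← hσ, σ.apply_symm_apply, σ.apply_symm_apply]

theorem IsPositioned.isDualWith (h : Φ.IsPositioned pos U) (h' : Ψ.IsPositioned pos' U')
    (hrange : Set.range pos = Set.range pos') (hΦ : Φ.IsCycleGraph) (hΨ : Ψ.IsCycleGraph)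
    {M : Matrix (Fin 2) (Fin 2) ℝ} (hM : realMatrix U = realMatrix U' * M)
    (hdir : ∀ i, M ≠ realMatrix (dirMatrix i)) : Φ.IsDualWith Ψ M := by
  let η : V ≃ W := (Equiv.ofInjective pos h.injective).trans
    ((Equiv.setCongr hrange).trans (Equiv.ofInjective pos' h'.injective).symm)
  have hη : ∀ a, pos' (η a) = pos a := fun a => by
    simp [η, Equiv.apply_ofInjective_symm]
  refine ⟨h.isDirectionGraph, h'.isDirectionGraph, hdir, ⟨h.isCoherent, hΦ.isConnected⟩,
    ⟨h'.isCoherent, hΨ.isConnected⟩, hΦ.exists_iso hΨ η, η, fun a b i hab => ?_⟩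
  obtain ⟨A, l, hA⟩ := hΦ.isConnected.2 a b
  refine ⟨A, ⟨l, hA⟩, ?_⟩
  rw [h.walk_sum hA, realMatrix_mul, hM, ← (h'.arc_iff _ _ _).1 hab, hη, hη, realMatrix_mul,
    Matrix.mul_assoc]

end LabeledDigraph

section Extraction

variable {V : Type*} {Φ : LabeledDigraph V} {p q : ℤ} {l : List Square}

theorem IsExtractedFrom.isCycleGraph (hΦ : IsExtractedFrom Φ p q l) (hl : IsLeaperCycle p q l) :
    Φ.IsCycleGraph := by
  obtain ⟨σ, hσ⟩ := hΦ
  obtain ⟨hnd, h3, hmove⟩ := hl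
  have hadj : ∀ a b, Φ.Adj (σ a) (σ b) ↔ CycAdj l a.1 b.1 := by
    refine fun a b => ⟨fun ⟨i, hi⟩ => ((hσ a b i).1 hi).1, ?_⟩
    rintro (h | h) <;> obtain ⟨i, hi⟩ := hmove _ _ h
    exacts [⟨i, (hσ a b i).2 ⟨.inl h, hi⟩⟩, ⟨i + 4, (hσ a b _).2 ⟨.inr h, hi.symm⟩⟩]
  obtain ⟨n, hn⟩ : ∃ n, l.length = n + 1 := Nat.exists_eq_add_of_le' (by omega)
  obtain ⟨φ, hφ⟩ := exists_equiv_cycleGraph hnd hn (by omega)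
  exact ⟨n, φ.trans σ, fun i j => (hadj _ _).trans (hφ i j)⟩

theorem IsExtractedFrom.exists_isPositioned (hΦ : IsExtractedFrom Φ p q l)
    {S : Set (Matrix (Fin 2) (Fin 2) ℤ)} {ev : Matrix (Fin 2) (Fin 2) ℤ → Square}
    (hev : Set.InjOn ev S) (hS : ev '' S = vertexSet l) {U : Matrix (Fin 2) (Fin 2) ℤ}
    (hU : IsUnit U) (hmove : ∀ P ∈ S, ∀ Q ∈ S, ∀ i,
      CycAdj l (ev P) (ev Q) ∧ MoveDir p q i (ev P) (ev Q) ↔ (Q - P) * U = dirMatrix i) :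
    ∃ pos, Set.range pos = S ∧ Φ.IsPositioned pos U := by
  obtain ⟨σ, hσ⟩ := hΦ
  let θ : V ≃ S := σ.symm.trans
    ((Equiv.setCongr hS.symm).trans (Equiv.Set.imageOfInjOn ev S hev).symm)
  have hθ : ∀ x, ev (θ x) = (σ.symm x).1 := fun x =>
    congrArg Subtype.val ((Equiv.Set.imageOfInjOn ev S hev).apply_symm_apply _)
  refine ⟨fun x => θ x, ?_, Subtype.val_injective.comp θ.injective, hU, fun x y i => ?_⟩
  · exact (θ.surjective.range_comp Subtype.val).trans Subtype.range_val
  · rw [← hmove _ (θ x).2 _ (θ y).2, hθ, hθ, ← σ.apply_symm_apply x, ← σ.apply_symm_apply y, hσ,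
      σ.symm_apply_apply, σ.symm_apply_apply]
    rfl

theorem exists_isExtractedFrom (p q : ℤ) (l : List Square) :
    ∃ (V : Type u) (Φ : LabeledDigraph V), IsExtractedFrom Φ p q l :=
  ⟨ULift {a // a ∈ l}, ⟨fun x y i => (Follows l x.down.1 y.down.1 ∨ Follows l y.down.1 x.down.1) ∧
    MoveDir p q i x.down.1 y.down.1⟩, Equiv.ulift.symm, fun _ _ _ => Iff.rfl⟩

end Extraction

/-! ### Frames and shells -/

/-- The signs `0`, `1`, `-1`, which tell the position of a band relative to the hole of a frame. -/
def IsSign (s : ℤ) : Prop := s = 0 ∨ s = 1 ∨ s = -1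

/-- The pair `x = (m, n)` gives the proportions of a frame with a nonempty hole, so that the
sections of the `(m, n)`-frame are disjoint. -/
def IsFrame (x : ℤ × ℤ) : Prop := 0 < x.1 ∧ x.1 < x.2

section Frames

variable {m n s s' x : ℤ} {i j k : Fin 8} {a b t : Square} {C : List Square}

theorem two_mul_abs_lt_iff {x y : ℤ} : 2 * |x| < y ↔ -y < 2 * x ∧ 2 * x < y := by
  rw [show 2 * |x| = |2 * x| by rw [abs_mul]; rfl, abs_lt]

theorem inBand_zero : InBand m n 0 x ↔ -(n - m) < 2 * x ∧ 2 * x < n - m := by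
  simp only [InBand, if_true, two_mul_abs_lt_iff]

theorem inBand_one : InBand m n 1 x ↔ n - m < 2 * x ∧ 2 * x < m + n := by
  simp [InBand]

theorem inBand_neg_one : InBand m n (-1) x ↔ n - m < -(2 * x) ∧ -(2 * x) < m + n := by
  simp [InBand]

theorem isSign_octVec : ∀ i : Fin 8, IsSign (octVec 1 1 i).1 ∧ IsSign (octVec 1 1 i).2 := by
  unfold IsSign
  decide

theorem octVec_one_one_injective : Function.Injective (octVec 1 1) := by
  unfold Function.Injective
  decide

theorem InBand.unique (hs : IsSign s) (hs' : IsSign s') (hmn : m < n) (h : InBand m n s x)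
    (h' : InBand m n s' x) : s = s' := by
  rcases hs with rfl | rfl | rfl <;> rcases hs' with rfl | rfl | rfl <;>
    simp only [inBand_zero, inBand_one, inBand_neg_one] at h h' <;> omega

theorem InBand.two_mul_abs_lt (hs : IsSign s) (hm : 0 < m) (hmn : m < n) (h : InBand m n s x) :
    2 * |x| < m + n := by
  rw [two_mul_abs_lt_iff]
  rcases hs with rfl | rfl | rfl <;>
    simp only [inBand_zero, inBand_one, inBand_neg_one] at h <;> omega

theorem frameSection_unique (hmn : m < n) (hi : a ∈ frameSection m n i)
    (hj : a ∈ frameSection m n j) : i = j :=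
  octVec_one_one_injective (Prod.ext
    (hi.1.unique (isSign_octVec i).1 (isSign_octVec j).1 hmn hj.1)
    (hi.2.unique (isSign_octVec i).2 (isSign_octVec j).2 hmn hj.2))

theorem frameSection_subset_board (hm : 0 < m) (hmn : m < n) (i : Fin 8) :
    frameSection m n i ⊆ board m n := fun _ ha =>
  ⟨ha.1.two_mul_abs_lt (isSign_octVec i).1 hm hmn, ha.2.two_mul_abs_lt (isSign_octVec i).2 hm hmn⟩

theorem dirMatrix_row_cases : ∀ k r,
    (dirMatrix k r 0 = 0 ∧ (dirMatrix k r 1 = 1 ∨ dirMatrix k r 1 = -1)) ∨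
    (dirMatrix k r 1 = 0 ∧ (dirMatrix k r 0 = 1 ∨ dirMatrix k r 0 = -1)) := by decide

theorem InBand.of_add_move {c d : ℤ} (hs : IsSign s)
    (hcd : (c = 0 ∧ (d = 1 ∨ d = -1)) ∨ (d = 0 ∧ (c = 1 ∨ c = -1))) (hmn : m < n)
    (h : InBand m n s x) (h' : 2 * |x + (c * m + d * n)| < m + n) :
    (d = 0 ∨ s = -d) ∧ (c = 0 ∨ s ≠ c) := by
  rw [two_mul_abs_lt_iff] at h'
  rcases hs with rfl | rfl | rfl <;>
    simp only [inBand_zero, inBand_one, inBand_neg_one] at h <;>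
    rcases hcd with ⟨rfl, rfl | rfl⟩ | ⟨rfl, rfl | rfl⟩ <;> omega

theorem eq_add_three_or_four_of_octVec : ∀ i k : Fin 8,
    (dirMatrix k 0 1 = 0 ∨ (octVec 1 1 i).1 = -dirMatrix k 0 1) ∧
      (dirMatrix k 0 0 = 0 ∨ (octVec 1 1 i).1 ≠ dirMatrix k 0 0) →
    (dirMatrix k 1 1 = 0 ∨ (octVec 1 1 i).2 = -dirMatrix k 1 1) ∧
      (dirMatrix k 1 0 = 0 ∨ (octVec 1 1 i).2 ≠ dirMatrix k 1 0) →
    k = i + 3 ∨ k = i + 4 := by decide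

-- A coordinate move by `± n` has to start in a band on the opposite side of the hole, and one by
-- `± m` in a band which is not on the same side.
theorem MoveDir.eq_add_three_or_four (hmn : m < n) (ha : a ∈ frameSection m n i)
    (hb : b ∈ board m n) (hab : MoveDir m n k a b) : k = i + 3 ∨ k = i + 4 := by
  rw [moveDir_iff] at hab
  rw [hab] at hb
  exact eq_add_three_or_four_of_octVec i k
    (ha.1.of_add_move (isSign_octVec i).1 (dirMatrix_row_cases k 0) hmn hb.1)
    (ha.2.of_add_move (isSign_octVec i).2 (dirMatrix_row_cases k 1) hmn hb.2)

theorem IsLeaperCycle.exists_moveDir_of_cycAdj (hC : IsLeaperCycle m n C) (h : CycAdj C a b) :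
    ∃ k, MoveDir m n k a b := by
  rcases h with h | h <;> obtain ⟨k, hk⟩ := hC.2.2 _ _ h
  exacts [⟨k, hk⟩, ⟨k + 4, hk.symm⟩]

-- At most two moves from `a` stay on the board, so they are the two moves along the cycle.
theorem IsLeaperCycle.cycAdj_of_moveDir (hmn : m < n) (hC : IsLeaperCycle m n C)
    (hboard : vertexSet C ⊆ board m n) (ha : a ∈ C) (hai : a ∈ frameSection m n i)
    (hb : b ∈ board m n) (hab : MoveDir m n k a b) : CycAdj C a b := by
  obtain ⟨c, d, hc, hd, hcd⟩ := exists_cycAdj_ne hC.1 hC.2.1 ha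
  obtain ⟨k₁, h₁⟩ := hC.exists_moveDir_of_cycAdj hc
  obtain ⟨k₂, h₂⟩ := hC.exists_moveDir_of_cycAdj hd
  have hne : k₁ ≠ k₂ := by
    rintro rfl
    exact hcd (h₁.right_unique h₂)
  have hk : k = k₁ ∨ k = k₂ := by
    rcases hab.eq_add_three_or_four hmn hai hb with rfl | rfl <;>
    rcases h₁.eq_add_three_or_four hmn hai (hboard hc.mem_right) with rfl | rfl <;>
    rcases h₂.eq_add_three_or_four hmn hai (hboard hd.mem_right) with rfl | rfl <;>
    simp_all only [ne_eq, not_true_eq_false, or_true, true_or]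
  rcases hk with rfl | rfl
  · rwa [hab.right_unique h₁]
  · rwa [hab.right_unique h₂]

/-- For `t` satisfying this condition, the eight squares at the offset `t` from the centres of the
subboards of the shell of an `(m, n)`-frame belong to the shell. -/
def IsShellOffset (m n : ℤ) (t : Square) : Prop :=
  (2 * |t.1| < n - m ∧ 2 * |t.1| < 3 * m - n) ∧ 2 * |t.2| < n - m ∧ 2 * |t.2| < 3 * m - n

theorem mem_shell_iff : a ∈ shell m n ↔ ∃ i, IsShellOffset m n (a - octVec (n - m) m i) := by
  refine exists_congr fun i => ?_
  simp only [IsShellOffset, Prod.fst_sub, Prod.snd_sub]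
  split_ifs <;> omega

theorem IsShellOffset.isFrame (ht : IsShellOffset m n t) : IsFrame (m, n) := by
  have h0 := abs_nonneg t.1
  unfold IsShellOffset at ht
  constructor <;> simp only <;> omega

theorem IsShellOffset.mem_frameSection (ht : IsShellOffset m n t) (i : Fin 8) :
    octVec (n - m) m i + t ∈ frameSection m n i := by
  obtain ⟨⟨h1, h2⟩, h3, h4⟩ := ht
  rw [two_mul_abs_lt_iff] at h1 h2 h3 h4
  fin_cases i <;>
    simp [frameSection, octVec, inBand_zero, inBand_one, inBand_neg_one] <;> omega

theorem moveDir_octVec (m n : ℤ) : ∀ i : Fin 8,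
    MoveDir m n (i + 3) (octVec (n - m) m i) (octVec (n - m) m (i + 3)) ∧
    MoveDir m n (i + 4) (octVec (n - m) m i) (octVec (n - m) m (i + 5)) := by
  intro i
  simp only [moveDir_iff, Prod.ext_iff, Prod.fst_add, Prod.snd_add, act]
  fin_cases i <;> simp [octVec, dirMatrix] <;> omega

theorem forall_of_add_three {p : Fin 8 → Prop} (hi : p i) (hp : ∀ j, p j → p (j + 3)) :
    ∀ j, p j := by
  have h : ∀ k : ℕ, p (i + k • 3) := by
    intro k
    induction k with
    | zero => simpa using hi
    | succ k ih => simpa only [succ_nsmul, add_assoc] using hp _ ih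
  intro j
  have hij : ∀ i j : Fin 8, i + (3 * (j - i).val) • 3 = j := by decide
  simpa only [hij] using h (3 * (j - i).val)

theorem IsShellCycle.exists_mem_frameSection (hC : IsShellCycle m n C) (ha : a ∈ C) :
    ∃ i, a ∈ frameSection m n i := by
  obtain ⟨i, hi⟩ := mem_shell_iff.1 (hC.2 ha)
  exact ⟨i, by simpa using hi.mem_frameSection i⟩

theorem IsShellCycle.exists_offset (hC : IsShellCycle m n C) :
    ∃ t, IsShellOffset m n t ∧ vertexSet C = Set.range fun i => octVec (n - m) m i + t := by
  obtain ⟨a, ha⟩ : ∃ a, a ∈ C := ⟨C[0]'(by have := hC.1.2.1; omega), List.getElem_mem _⟩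
  obtain ⟨i, ht⟩ := mem_shell_iff.1 (hC.2 ha)
  obtain ⟨t, rfl⟩ : ∃ t, octVec (n - m) m i + t = a := ⟨_, add_sub_cancel _ _⟩
  rw [add_sub_cancel_left] at ht
  obtain ⟨hm, hmn⟩ := ht.isFrame
  have hboard : vertexSet C ⊆ board m n := fun a ha =>
    let ⟨i, hi⟩ := hC.exists_mem_frameSection ha
    frameSection_subset_board hm hmn i hi
  refine ⟨t, ht, Set.Subset.antisymm ?_ (Set.range_subset_iff.2 ?_)⟩
  · refine forall_mem_of_cycNext ha ⟨i, rfl⟩ ?_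
    rintro _ b hab ⟨j, rfl⟩
    obtain ⟨k, hk⟩ := hC.1.2.2 _ _ hab
    rcases hk.eq_add_three_or_four hmn (ht.mem_frameSection j) (hboard hab.mem_right) with
      rfl | rfl
    · exact ⟨_, (hk.right_unique ((moveDir_octVec m n j).1.add_right t)).symm⟩
    · exact ⟨_, (hk.right_unique ((moveDir_octVec m n j).2.add_right t)).symm⟩
  · refine forall_of_add_three ha fun j hj => ?_
    have hnext := frameSection_subset_board hm hmn (j + 3) (ht.mem_frameSection (j + 3))
    exact (hC.1.cycAdj_of_moveDir hmn hboard hj (ht.mem_frameSection j) hnext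
      ((moveDir_octVec m n j).1.add_right t)).mem_right

end Frames

/-! ### Liftings of frames -/

namespace Lifting

variable {α β : Type*} {x : ℤ × ℤ} {i j : Fin 8}

theorem frame_eq_act (c : Lifting) (x : ℤ × ℤ) : c.frame x = act c.matrix x := by
  cases c <;> ext <;> simp [frame, act, matrix, sub_eq_neg_add]

theorem isFrame_frame (c : Lifting) (h : IsFrame x) : IsFrame (c.frame x) := by
  unfold IsFrame at *
  cases c <;> simp only [frame] <;> omega

theorem isSkewBasic_frame (c : Lifting) (h : IsSkewBasic x.1 x.2) :
    IsSkewBasic (c.frame x).1 (c.frame x).2 := by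
  obtain ⟨hpos, hlt, hodd, hcop⟩ := h
  have hframe := c.isFrame_frame ⟨hpos, hlt⟩
  refine ⟨hframe.1, hframe.2, ?_, ?_⟩
  · cases c <;> simp only [frame] <;> grind
  · cases c
    · simpa [frame, mul_comm] using hcop.mul_add_left_right 2
    · simpa [frame, sub_eq_neg_add, mul_comm] using hcop.symm.neg_right.add_mul_left_right 2
    · simpa [frame, mul_comm] using hcop.symm.add_mul_left_right 2

theorem isUnit_matrix (c : Lifting) : IsUnit c.matrix := by
  rw [Matrix.isUnit_iff_isUnit_det]
  cases c <;> simp [matrix, Matrix.det_fin_two_of]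

/-- The sections of the old frame whose squares are lifted to the `i`-th section, in the order in
which the corresponding paths are concatenated. -/
def sources : Lifting → Fin 8 → List (Fin 8)
  | f, i => if i.val % 2 = 0 then [i + 5, i + 4, i + 3] else [i]
  | g, i => if i.val % 2 = 0 then [i] else [i + 5, i + 4, i + 3]
  | h, i => if i.val % 2 = 0 then [i + 6, i + 5, i + 4, i + 3, i + 2] else [i - 1, i, i + 1]

/-- The lifted path in the `i`-th section is a concatenation of reversed paths. -/
def reverses : Lifting → Fin 8 → Bool
  | f, i => i.val % 2 = 0
  | g, i => i.val % 2 = 1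
  | h, i => i.val % 2 = 0

/-- The concatenation of old paths whose translate is the lifted path in the `i`-th section; the
entries of the paths may be squares or formal squares. -/
def combine (c : Lifting) (a : Fin 8 → List α) (i : Fin 8) : List α :=
  (c.sources i).flatMap fun j => if c.reverses i then (a j).reverse else a j

theorem liftPaths_eq (c : Lifting) (x : ℤ × ℤ) (a : Fin 8 → List Square) (i : Fin 8) :
    c.liftPaths x a i = (c.combine a i).map (· + c.translation x i) := by
  unfold liftPaths combine
  congr 1
  cases c <;> rcases Nat.mod_two_eq_zero_or_one i.val with h | h <;>
    simp [sources, reverses, h, List.flatMap_cons]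

theorem mem_combine {c : Lifting} {a : Fin 8 → List α} {y : α} :
    y ∈ c.combine a i ↔ ∃ j ∈ c.sources i, y ∈ a j := by
  refine List.mem_flatMap.trans (exists_congr fun j => and_congr_right fun _ => ?_)
  split_ifs <;> simp

theorem map_combine (φ : α → β) (c : Lifting) (a : Fin 8 → List α) (i : Fin 8) :
    (c.combine a i).map φ = c.combine (fun j => (a j).map φ) i := by
  refine List.map_flatMap.trans (congrArg (List.flatMap · _) (funext fun j => ?_))
  split_ifs <;> simp

theorem nodup_sources (c : Lifting) : ∀ i, (c.sources i).Nodup := by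
  cases c <;> decide

theorem sources_ne_nil (c : Lifting) : ∀ i, c.sources i ≠ [] := by
  cases c <;> decide

/-- The `i`-th translation of the lifting of an `(m, n)`-frame is the image of `(m, n)` under this
matrix. -/
def translationMatrix (c : Lifting) (i : Fin 8) : Matrix (Fin 2) (Fin 2) ℤ :=
  !![(c.translation (1, 0) i).1, (c.translation (0, 1) i).1;
    (c.translation (1, 0) i).2, (c.translation (0, 1) i).2]

theorem translation_eq_act (c : Lifting) (x : ℤ × ℤ) (i : Fin 8) :
    c.translation x i = act (c.translationMatrix i) x := by
  obtain ⟨m, n⟩ := x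
  cases c <;> fin_cases i <;> ext <;> simp [translation, translationMatrix, act, octVec] <;> ring

/-- The absolute value of the nonzero coordinates of the `i`-th translation. -/
def shift : Lifting → Fin 8 → ℤ × ℤ → ℤ
  | f, i, x => if i.val % 2 = 0 then x.1 + x.2 else x.1
  | g, i, x => if i.val % 2 = 0 then x.2 - x.1 else x.2
  | h, i, x => if i.val % 2 = 0 then x.1 + x.2 else x.2

theorem translation_eq_shift (c : Lifting) (x : ℤ × ℤ) (i : Fin 8) :
    c.translation x i = ((octVec 1 1 i).1 * c.shift i x, (octVec 1 1 i).2 * c.shift i x) := by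
  cases c <;> fin_cases i <;> simp [translation, shift, octVec]

/-- For the coordinates in the `i`-th section, the band on the side `s` of the old frame is lifted
to the band on the side `s'` of the new frame. -/
def liftsBand : Lifting → Fin 8 → ℤ → ℤ → Bool
  | f, i, s, s' => if i.val % 2 = 0 then s' = 0 ∨ s = -s' else s = s'
  | g, i, s, s' => if i.val % 2 = 0 then (s' = 0 ∧ s = 0) ∨ (s' ≠ 0 ∧ s ≠ -s') else s ≠ s'
  | h, i, s, s' => if i.val % 2 = 0 then s' = 0 ∨ s ≠ s' else s ≠ -s'

theorem inBand_frame_iff (c : Lifting) (i : Fin 8) {s s' y : ℤ} (hx : IsFrame x) (hs : IsSign s)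
    (hs' : IsSign s') (hi : i.val % 2 = 1 → s' ≠ 0) (hy : InBand x.1 x.2 s y) :
    InBand (c.frame x).1 (c.frame x).2 s' (y + s' * c.shift i x) ↔ c.liftsBand i s s' := by
  obtain ⟨hpos, hlt⟩ := hx
  rcases Nat.mod_two_eq_zero_or_one i.val with h | h <;>
    rcases hs' with rfl | rfl | rfl <;> rcases hs with rfl | rfl | rfl <;>
    simp only [inBand_zero, inBand_one, inBand_neg_one] at hy <;>
    cases c <;> simp [h] at hi <;>
    simp [h, liftsBand, shift, frame, inBand_zero, inBand_one, inBand_neg_one] <;>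
    omega

theorem liftsBand_iff_mem_sources (c : Lifting) : ∀ i j : Fin 8,
    (c.liftsBand i (octVec 1 1 j).1 (octVec 1 1 i).1 ∧
      c.liftsBand i (octVec 1 1 j).2 (octVec 1 1 i).2) ↔ j ∈ c.sources i := by
  cases c <;> decide

theorem octVec_ne_zero_of_odd : ∀ i : Fin 8, i.val % 2 = 1 →
    (octVec 1 1 i).1 ≠ 0 ∧ (octVec 1 1 i).2 ≠ 0 := by decide

theorem add_translation_mem_frameSection_iff (c : Lifting) (hx : IsFrame x) {a : Square}
    (ha : a ∈ frameSection x.1 x.2 j) :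
    a + c.translation x i ∈ frameSection (c.frame x).1 (c.frame x).2 i ↔ j ∈ c.sources i := by
  rw [← liftsBand_iff_mem_sources, translation_eq_shift]
  exact and_congr
    (c.inBand_frame_iff i hx (isSign_octVec j).1 (isSign_octVec i).1
      (fun h => (octVec_ne_zero_of_odd i h).1) ha.1)
    (c.inBand_frame_iff i hx (isSign_octVec j).2 (isSign_octVec i).2
      (fun h => (octVec_ne_zero_of_odd i h).2) ha.2)

end Lifting

section Words

variable {e d : List Lifting}

theorem wordMatrix_cons (c : Lifting) (e : List Lifting) :
    wordMatrix (c :: e) = c.matrix * wordMatrix e := by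
  simp only [wordMatrix, List.map_cons, List.prod_cons]

theorem isUnit_wordMatrix (e : List Lifting) : IsUnit (wordMatrix e) := by
  induction e with
  | nil => exact isUnit_one
  | cons c e ih => exact wordMatrix_cons c e ▸ c.isUnit_matrix.mul ih

theorem proportions_append (e d : List Lifting) :
    proportions (e ++ d) = act (wordMatrix e) (proportions d) := by
  induction e with
  | nil => exact (act_one _).symm
  | cons c e ih =>
    rw [wordMatrix_cons, act_mul, ← ih, ← c.frame_eq_act]
    rfl

theorem isFrame_act_wordMatrix (e : List Lifting) {x : ℤ × ℤ} (hx : IsFrame x) :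
    IsFrame (act (wordMatrix e) x) := by
  induction e with
  | nil => exact (act_one x).symm ▸ hx
  | cons c e ih =>
    rw [wordMatrix_cons, act_mul, ← c.frame_eq_act]
    exact c.isFrame_frame ih

theorem isSkewBasic_proportions (e : List Lifting) :
    IsSkewBasic (proportions e).1 (proportions e).2 := by
  induction e with
  | nil => exact ⟨by decide, by decide, by decide, 1, 0, by simp [proportions]⟩
  | cons c e ih => exact c.isSkewBasic_frame ih

theorem isFrame_proportions (e : List Lifting) : IsFrame (proportions e) :=
  ⟨(isSkewBasic_proportions e).1, (isSkewBasic_proportions e).2.1⟩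

end Words

/-! ### Formal squares -/

/-- A formal square `P` stands for the squares `P (m, n) + t` which correspond to each other in the
frames obtained from the various `(m, n)`-frames with shell offset `t` by the same liftings. -/
abbrev FormalSquare : Type := Matrix (Fin 2) (Fin 2) ℤ

/-- The square that the formal square `P` stands for if `x = (m, n)` and the shell offset is `t`. -/
def evalAt (x : ℤ × ℤ) (t : Square) (P : FormalSquare) : Square := act P x + t

/-- The centres `octVec (n - m) m i` of the subboards of a shell as formal squares. -/
def shellSquare (i : Fin 8) : FormalSquare :=
  !![(octVec (-1) 1 i).1, (octVec 1 0 i).1; (octVec (-1) 1 i).2, (octVec 1 0 i).2]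

/-- The copy in the `i`-th section, under the lifting `c`, of a formal square `P` of descent `e`. -/
def Lifting.liftSquare (c : Lifting) (e : List Lifting) (i : Fin 8) (P : FormalSquare) :
    FormalSquare :=
  P + c.translationMatrix i * wordMatrix e

/-- The formal squares in the `i`-th section of a partitioned second leaper cycle of descent `e`, in
the order of the cycle. -/
def formalPaths : List Lifting → Fin 8 → List FormalSquare
  | [], i => [shellSquare i]
  | c :: e, i => (c.combine (formalPaths e) i).map (c.liftSquare e i)

/-- The formal squares of the cycles of descent `e`. -/
def formalSquares (e : List Lifting) : Set FormalSquare := {P | ∃ i, P ∈ formalPaths e i}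

section FormalSquares

variable {x : ℤ × ℤ} {t : Square} {c : Lifting} {e : List Lifting} {i j : Fin 8}
  {P Q : FormalSquare}

theorem evalAt_add (x : ℤ × ℤ) (t : Square) (P Q : FormalSquare) :
    evalAt x t (P + Q) = evalAt x t P + act Q x := by
  rw [evalAt, act_add, add_right_comm, evalAt]

theorem evalAt_shellSquare (x : ℤ × ℤ) (t : Square) (i : Fin 8) :
    evalAt x t (shellSquare i) = octVec (x.2 - x.1) x.1 i + t := by
  unfold evalAt
  congr 1
  fin_cases i <;> ext <;> simp [shellSquare, act, octVec] <;> ring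

theorem evalAt_liftSquare (x : ℤ × ℤ) (t : Square) (P : FormalSquare) :
    evalAt x t (c.liftSquare e i P) = evalAt x t P + c.translation (act (wordMatrix e) x) i := by
  rw [Lifting.liftSquare, evalAt_add, act_mul, c.translation_eq_act]

theorem Lifting.liftSquare_injective : Function.Injective (c.liftSquare e i) :=
  add_left_injective _

theorem mem_formalPaths_nil : P ∈ formalPaths [] i ↔ P = shellSquare i := List.mem_singleton

theorem mem_formalPaths_cons :
    Q ∈ formalPaths (c :: e) i ↔
      ∃ j ∈ c.sources i, ∃ P ∈ formalPaths e j, c.liftSquare e i P = Q := by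
  simp only [formalPaths, List.mem_map, Lifting.mem_combine]
  grind

theorem liftSquare_mem_formalPaths (hP : P ∈ formalPaths e j) (hj : j ∈ c.sources i) :
    c.liftSquare e i P ∈ formalPaths (c :: e) i :=
  mem_formalPaths_cons.2 ⟨j, hj, P, hP, rfl⟩

theorem evalAt_mem_frameSection (ht : IsShellOffset x.1 x.2 t) (hP : P ∈ formalPaths e i) :
    evalAt x t P ∈ frameSection (act (wordMatrix e) x).1 (act (wordMatrix e) x).2 i := by
  induction e generalizing i P with
  | nil =>
    rw [mem_formalPaths_nil.1 hP, evalAt_shellSquare]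
    exact (act_one x).symm ▸ ht.mem_frameSection i
  | cons c e ih =>
    obtain ⟨j, hj, P, h, rfl⟩ := mem_formalPaths_cons.1 hP
    rw [evalAt_liftSquare, wordMatrix_cons, act_mul, ← c.frame_eq_act]
    exact (c.add_translation_mem_frameSection_iff (isFrame_act_wordMatrix e ht.isFrame) (ih h)).2 hj

theorem section_eq_of_evalAt_eq (ht : IsShellOffset x.1 x.2 t) (hP : P ∈ formalPaths e i)
    (hQ : Q ∈ formalPaths e j) (hPQ : evalAt x t P = evalAt x t Q) : i = j :=
  frameSection_unique (isFrame_act_wordMatrix e ht.isFrame).2 (evalAt_mem_frameSection ht hP)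
    (hPQ ▸ evalAt_mem_frameSection ht hQ)

theorem evalAt_injOn (ht : IsShellOffset x.1 x.2 t) (e : List Lifting) :
    Set.InjOn (evalAt x t) (formalSquares e) := by
  rintro P ⟨i, hP⟩ Q ⟨j, hQ⟩ hPQ
  induction e generalizing i j P Q with
  | nil =>
    obtain rfl := section_eq_of_evalAt_eq ht hP hQ hPQ
    rw [mem_formalPaths_nil.1 hP, mem_formalPaths_nil.1 hQ]
  | cons c e ih =>
    obtain rfl := section_eq_of_evalAt_eq ht hP hQ hPQ
    obtain ⟨_, _, P₀, hP₀, rfl⟩ := mem_formalPaths_cons.1 hP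
    obtain ⟨_, _, Q₀, hQ₀, rfl⟩ := mem_formalPaths_cons.1 hQ
    rw [evalAt_liftSquare, evalAt_liftSquare, add_left_inj] at hPQ
    rw [ih _ hP₀ _ hQ₀ hPQ]

theorem isShellOffset_one_two : IsShellOffset 1 2 0 := by
  simp [IsShellOffset]

theorem formalPaths_section_unique (hi : P ∈ formalPaths e i) (hj : P ∈ formalPaths e j) : i = j :=
  section_eq_of_evalAt_eq (x := (1, 2)) isShellOffset_one_two hi hj rfl

theorem formalPaths_nodup (e : List Lifting) (i : Fin 8) : (formalPaths e i).Nodup := by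
  induction e generalizing i with
  | nil => exact List.nodup_singleton _
  | cons c e ih =>
    refine List.Nodup.map Lifting.liftSquare_injective (List.nodup_flatMap.2 ⟨fun j _ => ?_, ?_⟩)
    · split_ifs <;> simp only [List.nodup_reverse, ih]
    · refine (c.nodup_sources i).imp fun hjk P hj hk => ?_
      refine hjk (formalPaths_section_unique (e := e) (P := P) ?_ ?_)
      · split_ifs at hj <;> simpa using hj
      · split_ifs at hk <;> simpa using hk

/-- The second leaper cycle of descent `e`, as a cycle of formal squares. -/
def formalCycle (e : List Lifting) : List FormalSquare := (List.ofFn (formalPaths e)).flatten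

theorem mem_formalCycle : P ∈ formalCycle e ↔ P ∈ formalSquares e := by
  simp only [formalCycle, List.mem_flatten, List.mem_ofFn, formalSquares, Set.mem_ofPred_eq]
  grind

theorem formalCycle_nodup (e : List Lifting) : (formalCycle e).Nodup := by
  refine List.nodup_flatten.2 ⟨List.forall_mem_ofFn_iff.2 (formalPaths_nodup e), ?_⟩
  exact List.pairwise_ofFn.2 fun i j hij P hP hQ => hij.ne (formalPaths_section_unique hP hQ)

theorem liftSets_eq_image {d : List Lifting}
    (ht : IsShellOffset (proportions d).1 (proportions d).2 t) (e : List Lifting) :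
    liftSets d e
      (Set.range fun i => octVec ((proportions d).2 - (proportions d).1) (proportions d).1 i + t) =
    evalAt (proportions d) t '' formalSquares e := by
  induction e with
  | nil =>
    ext a
    simp [liftSets, formalSquares, mem_formalPaths_nil, evalAt_shellSquare]
  | cons c e ih =>
    have hlift {i j P} (hP : P ∈ formalPaths e j) : evalAt (proportions d) t (c.liftSquare e i P) ∈
        frameSection (proportions (c :: e ++ d)).1 (proportions (c :: e ++ d)).2 i ↔
          j ∈ c.sources i := by
      rw [evalAt_liftSquare, List.cons_append, proportions, proportions_append]
      exact c.add_translation_mem_frameSection_iff (isFrame_act_wordMatrix e ht.isFrame)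
        (evalAt_mem_frameSection ht hP)
    ext b
    constructor
    · rintro ⟨i, hb, hS⟩
      rw [ih] at hS
      obtain ⟨P, ⟨j, hP⟩, hPb⟩ := hS
      rw [eq_sub_iff_add_eq, proportions_append, ← evalAt_liftSquare] at hPb
      subst hPb
      exact ⟨_, ⟨i, liftSquare_mem_formalPaths hP ((hlift hP).1 hb)⟩, rfl⟩
    · rintro ⟨_, ⟨i, hQ⟩, rfl⟩
      obtain ⟨j, hj, P, hP, rfl⟩ := mem_formalPaths_cons.1 hQ
      refine ⟨i, (hlift hP).2 hj, ih ▸ ⟨P, ⟨j, hP⟩, ?_⟩⟩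
      rw [evalAt_liftSquare, proportions_append, add_sub_cancel_right]

theorem liftCycles_eq_map (d e : List Lifting) (t : Square) :
    liftCycles d e (fun i =>
      [octVec ((proportions d).2 - (proportions d).1) (proportions d).1 i + t]) =
    fun i => (formalPaths e i).map (evalAt (proportions d) t) := by
  induction e with
  | nil => simp only [liftCycles, formalPaths, List.map_cons, evalAt_shellSquare, List.map_nil]
  | cons c e ih =>
    ext1 i
    rw [liftCycles, c.liftPaths_eq, ih, formalPaths, ← c.map_combine, List.map_map, List.map_map]
    exact List.map_congr_left fun P _ => by
      simp only [Function.comp_apply, evalAt_liftSquare, proportions_append]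

end FormalSquares

/-! ### Moves of the first leaper between formal squares -/

/-- A move of direction `k` of the first leaper can lead from the `i`-th section of its frame to the
`j`-th one without leaving the board. -/
def StepsTo (i k j : Fin 8) : Prop := (k = i + 3 ∨ k = i + 4) ∧ (j = k ∨ j = k + 1)

instance (i k j : Fin 8) : Decidable (StepsTo i k j) := inferInstanceAs (Decidable (_ ∧ _))

namespace Lifting

/-- A move of direction `k` leads from the copy in the `i`-th section of any formal square `P` of
descent `e` to the copy in the `i'`-th section of the formal square `P + M * wordMatrix e`. -/
def MovesCopies (c : Lifting) (i k i' : Fin 8) (M : Matrix (Fin 2) (Fin 2) ℤ) : Prop :=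
  c.translationMatrix i + dirMatrix k * c.matrix = M + c.translationMatrix i'

instance (c : Lifting) (i k i' : Fin 8) (M : Matrix (Fin 2) (Fin 2) ℤ) :
    Decidable (c.MovesCopies i k i' M) := inferInstanceAs (Decidable (_ = _))

theorem MovesCopies.liftSquare_add {c : Lifting} {i k i' : Fin 8} {M : Matrix (Fin 2) (Fin 2) ℤ}
    (h : c.MovesCopies i k i' M) (e : List Lifting) (P : FormalSquare) :
    c.liftSquare e i P + dirMatrix k * wordMatrix (c :: e) =
      c.liftSquare e i' (P + M * wordMatrix e) := by
  unfold liftSquare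
  rw [wordMatrix_cons, ← Matrix.mul_assoc, add_assoc, ← Matrix.add_mul, h, Matrix.add_mul,
    add_assoc]

theorem exists_movesCopies_of_mem_sources (c : Lifting) : ∀ i k j, k = i + 3 ∨ k = i + 4 →
    j ∈ c.sources i → ∃ i', StepsTo i k i' ∧
      ((j ∈ c.sources i' ∧ c.MovesCopies i k i' 0) ∨ ∃ k', (k' = j + 3 ∨ k' = j + 4) ∧
        (∀ j', StepsTo j k' j' → j' ∈ c.sources i') ∧ c.MovesCopies i k i' (dirMatrix k')) := by
  cases c <;> decide

theorem exists_movesCopies_of_stepsTo (c : Lifting) : ∀ j k j', StepsTo j k j' →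
    ∃ i i' k', j ∈ c.sources i ∧ j' ∈ c.sources i' ∧ c.MovesCopies i k' i' (dirMatrix k) := by
  cases c <;> decide

/-- The section of a distinguished copy of the formal squares of the `j`-th section, to which at
most two moves lead from any other copy. -/
def hub : Lifting → Fin 8 → Fin 8
  | f, j => if j.val % 2 = 0 then j + 4 else j
  | g, j => if j.val % 2 = 0 then j else j + 4
  | h, j => if j.val % 2 = 0 then j + 4 else j

theorem exists_movesCopies_hub (c : Lifting) : ∀ i j, j ∈ c.sources i → ∃ i', j ∈ c.sources i' ∧
    (i' = i ∨ ∃ k, c.MovesCopies i k i' 0) ∧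
    (c.hub j = i' ∨ ∃ k, c.MovesCopies i' k (c.hub j) 0) := by
  cases c <;> decide

theorem mem_sources_hub (c : Lifting) : ∀ j, j ∈ c.sources (c.hub j) := by
  cases c <;> decide

end Lifting

section MoveGraph

variable {c : Lifting} {e : List Lifting} {i i' j k : Fin 8} {P Q : FormalSquare}

theorem shellSquare_add_dirMatrix : ∀ i k, k = i + 3 ∨ k = i + 4 →
    ∃ j, StepsTo i k j ∧ shellSquare i + dirMatrix k = shellSquare j := by decide

theorem exists_add_move_mem_formalPaths (hP : P ∈ formalPaths e i) (hk : k = i + 3 ∨ k = i + 4) :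
    ∃ j, StepsTo i k j ∧ P + dirMatrix k * wordMatrix e ∈ formalPaths e j := by
  induction e generalizing i k P with
  | nil =>
    rw [mem_formalPaths_nil.1 hP]
    obtain ⟨j, hj, h⟩ := shellSquare_add_dirMatrix i k hk
    exact ⟨j, hj, mem_formalPaths_nil.2 (by simpa [wordMatrix] using h)⟩
  | cons c e ih =>
    obtain ⟨j, hj, P₀, hP₀, rfl⟩ := mem_formalPaths_cons.1 hP
    obtain ⟨i', hi', ⟨hj', h⟩ | ⟨k', hk', hsub, h⟩⟩ :=
      c.exists_movesCopies_of_mem_sources i k j hk hj <;> refine ⟨i', hi', ?_⟩ <;>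
      rw [h.liftSquare_add]
    · simpa using liftSquare_mem_formalPaths hP₀ hj'
    · obtain ⟨j', hj', hP'⟩ := ih hP₀ hk'
      exact liftSquare_mem_formalPaths hP' (hsub j' hj')

/-- The graph of the moves of the first leaper on the formal squares of descent `e`. -/
def moveGraph (e : List Lifting) : SimpleGraph (formalSquares e) where
  Adj P Q := ∃ k, P.1 + dirMatrix k * wordMatrix e = Q.1
  symm := ⟨fun P Q ⟨k, h⟩ => ⟨k + 4, by
    rw [← h, dirMatrix_add_four, Matrix.neg_mul, add_neg_cancel_right]⟩⟩
  loopless := ⟨fun P ⟨k, h⟩ => by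
    rw [add_eq_left, (isUnit_wordMatrix e).mul_left_eq_zero] at h
    revert k
    decide⟩

theorem moveDir_evalAt (x : ℤ × ℤ) (t : Square) (h : P + dirMatrix k * wordMatrix e = Q) :
    MoveDir (act (wordMatrix e) x).1 (act (wordMatrix e) x).2 k (evalAt x t P) (evalAt x t Q) := by
  rw [moveDir_iff, ← h, evalAt_add, act_mul]

theorem eq_add_three_or_four_of_move (hP : P ∈ formalPaths e i) (hQ : Q ∈ formalPaths e j)
    (h : P + dirMatrix k * wordMatrix e = Q) : k = i + 3 ∨ k = i + 4 :=
  have ⟨hpos, hlt⟩ := isFrame_act_wordMatrix e isShellOffset_one_two.isFrame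
  (moveDir_evalAt (1, 2) 0 h).eq_add_three_or_four hlt
    (evalAt_mem_frameSection isShellOffset_one_two hP)
    (frameSection_subset_board hpos hlt j (evalAt_mem_frameSection isShellOffset_one_two hQ))

theorem exists_stepsTo_of_adj {P Q : formalSquares e} (h : (moveGraph e).Adj P Q) :
    ∃ i k j, P.1 ∈ formalPaths e i ∧ Q.1 ∈ formalPaths e j ∧ StepsTo i k j ∧
      P.1 + dirMatrix k * wordMatrix e = Q.1 := by
  obtain ⟨i, hi⟩ := P.2
  obtain ⟨j, hj⟩ := Q.2
  obtain ⟨k, hk⟩ := h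
  obtain ⟨j', hstep, hj'⟩ :=
    exists_add_move_mem_formalPaths hi (eq_add_three_or_four_of_move hi hj hk)
  obtain rfl := formalPaths_section_unique hj (hk ▸ hj')
  exact ⟨i, k, j, hi, hj, hstep, hk⟩

theorem ncard_neighborSet_moveGraph (e : List Lifting) (P : formalSquares e) :
    ((moveGraph e).neighborSet P).ncard = 2 := by
  obtain ⟨P, i, hi⟩ := P
  obtain ⟨j, -, hj⟩ := exists_add_move_mem_formalPaths hi (.inl rfl)
  obtain ⟨j', -, hj'⟩ := exists_add_move_mem_formalPaths hi (.inr rfl)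
  refine Set.ncard_eq_two.2 ⟨⟨_, j, hj⟩, ⟨_, j', hj'⟩, fun h => ?_, Set.ext fun Q => ?_⟩
  · have h := dirMatrix_injective ((isUnit_wordMatrix e).mul_left_injective
      (add_left_cancel (Subtype.mk.inj h)))
    exact absurd (add_left_cancel h) (by decide)
  · simp only [SimpleGraph.mem_neighborSet, moveGraph, Set.mem_insert_iff, Set.mem_singleton_iff,
      Subtype.ext_iff]
    constructor
    · rintro ⟨k, hk⟩
      obtain ⟨_, hQ⟩ := Q.2
      rw [← hk]
      rcases eq_add_three_or_four_of_move hi hQ hk with rfl | rfl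
      exacts [.inl rfl, .inr rfl]
    · rintro (h | h)
      exacts [⟨_, h.symm⟩, ⟨_, h.symm⟩]

theorem preconnected_moveGraph_nil : (moveGraph []).Preconnected := by
  have hshell : ∀ i, shellSquare i ∈ formalSquares [] := fun i => ⟨i, mem_formalPaths_nil.2 rfl⟩
  have hmove : ∀ i, shellSquare i + dirMatrix (i + 3) = shellSquare (i + 3) := by decide
  rintro ⟨P, i, hP⟩ ⟨Q, j, hQ⟩
  obtain rfl := mem_formalPaths_nil.1 hP
  obtain rfl := mem_formalPaths_nil.1 hQ
  refine forall_of_add_three (p := fun j => (moveGraph []).Reachable _ ⟨_, hshell j⟩) (.refl _)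
    (fun j hj => hj.trans (SimpleGraph.Adj.reachable ⟨j + 3, ?_⟩)) j
  simpa [wordMatrix] using hmove j

theorem reachable_liftSquare_liftSquare (hP : P ∈ formalPaths e j) (hi : j ∈ c.sources i)
    (hi' : j ∈ c.sources i') :
    (moveGraph (c :: e)).Reachable ⟨c.liftSquare e i P, i, liftSquare_mem_formalPaths hP hi⟩
      ⟨c.liftSquare e i' P, i', liftSquare_mem_formalPaths hP hi'⟩ := by
  have hadj {i i' k} (hi : j ∈ c.sources i) (hi' : j ∈ c.sources i') (h : c.MovesCopies i k i' 0) :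
      (moveGraph (c :: e)).Reachable ⟨c.liftSquare e i P, i, liftSquare_mem_formalPaths hP hi⟩
        ⟨c.liftSquare e i' P, i', liftSquare_mem_formalPaths hP hi'⟩ :=
    SimpleGraph.Adj.reachable ⟨k, by simpa using h.liftSquare_add e P⟩
  have hub_mem := liftSquare_mem_formalPaths hP (c.mem_sources_hub j)
  suffices hhub : ∀ {i} (hi : j ∈ c.sources i), (moveGraph (c :: e)).Reachable
      ⟨c.liftSquare e i P, i, liftSquare_mem_formalPaths hP hi⟩
      ⟨c.liftSquare e (c.hub j) P, c.hub j, hub_mem⟩ from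
    (hhub hi).trans (hhub hi').symm
  intro i hi
  obtain ⟨i', hi', hfst, hsnd⟩ := c.exists_movesCopies_hub i j hi
  refine SimpleGraph.Reachable.trans
    (v := ⟨c.liftSquare e i' P, i', liftSquare_mem_formalPaths hP hi'⟩) ?_ ?_
  · rcases hfst with rfl | ⟨k, h⟩
    exacts [.refl _, hadj hi hi' h]
  · rcases hsnd with rfl | ⟨k, h⟩
    exacts [.refl _, hadj hi' (c.mem_sources_hub j) h]

theorem reachable_liftSquare {P Q : formalSquares e} (w : (moveGraph e).Walk P Q) {jP jQ : Fin 8}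
    (hP : P.1 ∈ formalPaths e jP) (hQ : Q.1 ∈ formalPaths e jQ) (hi : jP ∈ c.sources i)
    (hi' : jQ ∈ c.sources i') :
    (moveGraph (c :: e)).Reachable ⟨c.liftSquare e i P, i, liftSquare_mem_formalPaths hP hi⟩
      ⟨c.liftSquare e i' Q, i', liftSquare_mem_formalPaths hQ hi'⟩ := by
  induction w generalizing jP i with
  | nil =>
    obtain rfl := formalPaths_section_unique hP hQ
    exact reachable_liftSquare_liftSquare hP hi hi'
  | cons h _ ih =>
    obtain ⟨jP', k, jR, hP', hR, hstep, hk⟩ := exists_stepsTo_of_adj h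
    obtain rfl := formalPaths_section_unique hP hP'
    obtain ⟨a, b, k', ha, hb, hmove⟩ := c.exists_movesCopies_of_stepsTo jP k jR hstep
    refine (reachable_liftSquare_liftSquare hP hi ha).trans (.trans ?_ (ih hR hQ hb))
    exact SimpleGraph.Adj.reachable ⟨k', by rw [hmove.liftSquare_add, hk]⟩

theorem preconnected_moveGraph (e : List Lifting) : (moveGraph e).Preconnected := by
  induction e with
  | nil => exact preconnected_moveGraph_nil
  | cons c e ih =>
    rintro ⟨P, i, hP⟩ ⟨Q, i', hQ⟩
    obtain ⟨j, hj, P₀, hP₀, rfl⟩ := mem_formalPaths_cons.1 hP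
    obtain ⟨j', hj', Q₀, hQ₀, rfl⟩ := mem_formalPaths_cons.1 hQ
    obtain ⟨w⟩ := ih ⟨P₀, j, hP₀⟩ ⟨Q₀, j', hQ₀⟩
    exact reachable_liftSquare w hP₀ hQ₀ hj hj'

end MoveGraph

/-! ### Ends of the lifted paths -/

section FlatMap

variable {α β : Type*} {φ : α → List β} {ψ : α → β}

theorem head?_flatMap_of_head?_eq_some (h : ∀ a, (φ a).head? = some (ψ a)) (l : List α) :
    (l.flatMap φ).head? = l.head?.map ψ := by
  cases l <;> simp [h]

theorem getLast?_flatMap_of_getLast?_eq_some (h : ∀ a, (φ a).getLast? = some (ψ a)) (l : List α) :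
    (l.flatMap φ).getLast? = l.getLast?.map ψ := by
  rcases l.eq_nil_or_concat' with rfl | ⟨l, a, rfl⟩ <;> simp [h]

end FlatMap

namespace Lifting

variable {α : Type*} {a : Fin 8 → List α} {first last : Fin 8 → α}

theorem head?_combine (hfirst : ∀ j, (a j).head? = some (first j))
    (hlast : ∀ j, (a j).getLast? = some (last j)) (c : Lifting) (i : Fin 8) :
    (c.combine a i).head? =
      (c.sources i).head?.map fun j => if c.reverses i then last j else first j :=
  head?_flatMap_of_head?_eq_some (fun j => by split_ifs <;> simp [hfirst, hlast]) _

theorem getLast?_combine (hfirst : ∀ j, (a j).head? = some (first j))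
    (hlast : ∀ j, (a j).getLast? = some (last j)) (c : Lifting) (i : Fin 8) :
    (c.combine a i).getLast? =
      (c.sources i).getLast?.map fun j => if c.reverses i then first j else last j :=
  getLast?_flatMap_of_getLast?_eq_some (fun j => by split_ifs <;> simp [hfirst, hlast]) _

theorem isChain_sources (c : Lifting) : ∀ i : Fin 8,
    (c.sources i).IsChain fun j j' => if c.reverses i then j = j' + 1 else j' = j + 1 := by
  cases c <;> decide

theorem isChain_combine {R : α → α → Prop} (hR : ∀ {y z}, R y z → R z y)
    (hfirst : ∀ j, (a j).head? = some (first j)) (hlast : ∀ j, (a j).getLast? = some (last j))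
    (hchain : ∀ j, (a j).IsChain R) (hjunction : ∀ j, R (last j) (first (j + 1))) (c : Lifting)
    (i : Fin 8) : (c.combine a i).IsChain R := by
  have hne (j) : a j ≠ [] := fun h => by simpa [h] using hfirst j
  have hreverse (j) : (a j).reverse.IsChain R :=
    List.isChain_reverse.2 ((hchain j).imp fun _ _ h => hR h)
  rw [combine, List.flatMap_def, List.isChain_flatten]
  · refine ⟨List.forall_mem_map.2 fun j _ => by split_ifs; exacts [hreverse j, hchain j], ?_⟩
    rw [List.isChain_map]
    refine (c.isChain_sources i).imp fun j j' h => ?_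
    split_ifs at h ⊢ with hr
    · simp only [List.getLast?_reverse, List.head?_reverse, hfirst, hlast, Option.mem_def,
        Option.some.injEq, forall_eq']
      exact h ▸ hR (hjunction j')
    · simp only [hfirst, hlast, Option.mem_def, Option.some.injEq, forall_eq']
      exact h ▸ hjunction j
  · rw [List.mem_map]
    rintro ⟨j, -, hj⟩
    split_ifs at hj
    exacts [hne j (List.reverse_eq_nil_iff.1 hj), hne j hj]

/-- The first square `P` of the northeast path of descent `e` is lifted by `c` to the formal square
`c.cornerCoeff * P + c.cornerShift * wordMatrix e`. -/
def cornerCoeff : Lifting → Matrix (Fin 2) (Fin 2) ℤ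
  | f => 1
  | g => 1
  | h => dirMatrix 4

/-- The constant term in the lift of the first square of the northeast path; see
`Lifting.cornerCoeff`. -/
def cornerShift : Lifting → Matrix (Fin 2) (Fin 2) ℤ
  | f => !![1, 0; 1, 0]
  | g => !![-1, 1; 0, 0]
  | h => !![0, 2; 1, 1]

end Lifting

/-- The first formal square of the northeast path of descent `e`. The dihedral symmetry of the
cycle determines the ends of all eight paths from this one. -/
def corner : List Lifting → FormalSquare
  | [] => shellSquare 1
  | c :: e => c.cornerCoeff * corner e + c.cornerShift * wordMatrix e

/-- The coefficients at `corner e` and at `wordMatrix e` of the first square of the `i`-th path. -/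
def headCoeff (i : Fin 8) : Matrix (Fin 2) (Fin 2) ℤ × Matrix (Fin 2) (Fin 2) ℤ :=
  if i.val % 2 = 0 then (dirMatrix (i + 4), -dirMatrix (i + 4)) else (dirMatrix i, 0)

/-- The coefficients at `corner e` and at `wordMatrix e` of the last square of the `i`-th path. -/
def lastCoeff (i : Fin 8) : Matrix (Fin 2) (Fin 2) ℤ × Matrix (Fin 2) (Fin 2) ℤ :=
  if i.val % 2 = 0 then (dirMatrix (i + 3), -dirMatrix (i + 3)) else (dirMatrix (i + 7), 0)

/-- The first formal square of the `i`-th path of descent `e`. -/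
def pathHead (e : List Lifting) (i : Fin 8) : FormalSquare :=
  (headCoeff i).1 * corner e + (headCoeff i).2 * wordMatrix e

/-- The last formal square of the `i`-th path of descent `e`. -/
def pathLast (e : List Lifting) (i : Fin 8) : FormalSquare :=
  (lastCoeff i).1 * corner e + (lastCoeff i).2 * wordMatrix e

section PathEnds

variable {c : Lifting} {e : List Lifting} {i j : Fin 8} {P Q : FormalSquare}

theorem pathHead_nil : ∀ i, pathHead [] i = shellSquare i := by decide

theorem pathLast_nil : ∀ i, pathLast [] i = shellSquare i := by decide

/-- The linear combination of `corner` and `wordMatrix` with coefficients `p` for the word `c :: e`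
is the copy in the `i`-th section of the one with coefficients `q` for the word `e`. -/
def LiftsCoeff (c : Lifting) (i : Fin 8)
    (q p : Matrix (Fin 2) (Fin 2) ℤ × Matrix (Fin 2) (Fin 2) ℤ) : Prop :=
  p.1 * c.cornerCoeff = q.1 ∧ p.1 * c.cornerShift + p.2 * c.matrix = q.2 + c.translationMatrix i

instance (c : Lifting) (i : Fin 8)
    (q p : Matrix (Fin 2) (Fin 2) ℤ × Matrix (Fin 2) (Fin 2) ℤ) : Decidable (LiftsCoeff c i q p) :=
  inferInstanceAs (Decidable (_ ∧ _))

theorem LiftsCoeff.eq_liftSquare {p q : Matrix (Fin 2) (Fin 2) ℤ × Matrix (Fin 2) (Fin 2) ℤ}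
    (h : LiftsCoeff c i q p) (e : List Lifting) :
    p.1 * corner (c :: e) + p.2 * wordMatrix (c :: e) =
      c.liftSquare e i (q.1 * corner e + q.2 * wordMatrix e) := by
  rw [Lifting.liftSquare, add_assoc, ← Matrix.add_mul, ← h.1, ← h.2, corner, wordMatrix_cons]
  simp only [Matrix.mul_add, Matrix.add_mul, Matrix.mul_assoc, add_assoc]

theorem liftsCoeff_headCoeff (c : Lifting) : ∀ i j, j ∈ (c.sources i).head? →
    LiftsCoeff c i (if c.reverses i then lastCoeff j else headCoeff j) (headCoeff i) := by
  cases c <;> decide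

theorem liftsCoeff_lastCoeff (c : Lifting) : ∀ i j, j ∈ (c.sources i).getLast? →
    LiftsCoeff c i (if c.reverses i then headCoeff j else lastCoeff j) (lastCoeff i) := by
  cases c <;> decide

theorem pathHead_cons (hj : j ∈ (c.sources i).head?) : pathHead (c :: e) i =
    c.liftSquare e i (if c.reverses i then pathLast e j else pathHead e j) := by
  rw [pathHead, (liftsCoeff_headCoeff c i j hj).eq_liftSquare]
  split_ifs <;> rfl

theorem pathLast_cons (hj : j ∈ (c.sources i).getLast?) : pathLast (c :: e) i =
    c.liftSquare e i (if c.reverses i then pathHead e j else pathLast e j) := by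
  rw [pathLast, (liftsCoeff_lastCoeff c i j hj).eq_liftSquare]
  split_ifs <;> rfl

theorem head?_getLast?_formalPaths (e : List Lifting) (i : Fin 8) :
    (formalPaths e i).head? = some (pathHead e i) ∧
      (formalPaths e i).getLast? = some (pathLast e i) := by
  induction e generalizing i with
  | nil => simp only [formalPaths, pathHead_nil, pathLast_nil, List.head?_singleton,
      List.getLast?_singleton, and_self]
  | cons c e ih =>
    have hsources : c.sources i ≠ [] := c.sources_ne_nil i
    have hhead := List.head?_eq_some_head hsources
    have hlast := List.getLast?_eq_some_getLast hsources
    rw [formalPaths, List.head?_map, List.getLast?_map,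
      c.head?_combine (fun j => (ih j).1) (fun j => (ih j).2),
      c.getLast?_combine (fun j => (ih j).1) (fun j => (ih j).2), pathHead_cons hhead,
      pathLast_cons hlast, hhead, hlast]
    exact ⟨rfl, rfl⟩

theorem head?_formalPaths (e : List Lifting) (i : Fin 8) :
    (formalPaths e i).head? = some (pathHead e i) :=
  (head?_getLast?_formalPaths e i).1

theorem getLast?_formalPaths (e : List Lifting) (i : Fin 8) :
    (formalPaths e i).getLast? = some (pathLast e i) :=
  (head?_getLast?_formalPaths e i).2

theorem pathHead_mem_formalPaths (e : List Lifting) (i : Fin 8) :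
    pathHead e i ∈ formalPaths e i :=
  List.mem_of_head? (head?_formalPaths e i)

theorem pathLast_mem_formalPaths (e : List Lifting) (i : Fin 8) :
    pathLast e i ∈ formalPaths e i :=
  List.mem_of_getLast? (getLast?_formalPaths e i)

theorem formalPaths_ne_nil (e : List Lifting) (i : Fin 8) : formalPaths e i ≠ [] :=
  List.ne_nil_of_mem (pathHead_mem_formalPaths e i)

end PathEnds

/-! ### Moves of the second leaper between formal squares -/

/-- The moves of the second leaper between formal squares are `dirMatrix k * secondMatrix`. This
matrix is the inverse of that of the lifting `g`, and differs from that of `h` by a direction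
matrix. -/
def secondMatrix : Matrix (Fin 2) (Fin 2) ℤ := !![2, -1; 1, 0]

/-- The formal squares `P` and `Q` are joined by a move of the second leaper. -/
def SecondMove (P Q : FormalSquare) : Prop := ∃ k, P + dirMatrix k * secondMatrix = Q

section SecondMove

variable {e : List Lifting} {i : Fin 8} {P Q : FormalSquare}

theorem SecondMove.symm (h : SecondMove P Q) : SecondMove Q P := by
  obtain ⟨k, rfl⟩ := h
  exact ⟨k + 4, by rw [dirMatrix_add_four, Matrix.neg_mul, add_neg_cancel_right]⟩

theorem SecondMove.add_right (h : SecondMove P Q) (R : FormalSquare) :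
    SecondMove (P + R) (Q + R) := by
  obtain ⟨k, rfl⟩ := h
  exact ⟨k, add_right_comm _ _ _⟩

theorem exists_dirMatrix_mul : ∀ k k', ∃ k'', dirMatrix k * dirMatrix k' = dirMatrix k'' := by
  decide

theorem exists_dirMatrix_corner (c : Lifting) : ∃ k,
    (1 - dirMatrix 3) * c.cornerCoeff = dirMatrix k * (1 - dirMatrix 3) ∧
    (1 - dirMatrix 3) * c.cornerShift + dirMatrix 3 * c.matrix = dirMatrix k * dirMatrix 3 := by
  cases c <;> decide

theorem exists_corner_eq_dirMatrix_mul (e : List Lifting) : ∃ k,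
    (1 - dirMatrix 3) * corner e + dirMatrix 3 * wordMatrix e = dirMatrix k * secondMatrix := by
  induction e with
  | nil => decide
  | cons c e ih =>
    obtain ⟨k, hk⟩ := ih
    obtain ⟨k', hcoeff, hshift⟩ := exists_dirMatrix_corner c
    obtain ⟨k'', hk''⟩ := exists_dirMatrix_mul k' k
    refine ⟨k'', ?_⟩
    calc (1 - dirMatrix 3) * corner (c :: e) + dirMatrix 3 * wordMatrix (c :: e)
      _ = (1 - dirMatrix 3) * c.cornerCoeff * corner e +
          ((1 - dirMatrix 3) * c.cornerShift + dirMatrix 3 * c.matrix) * wordMatrix e := by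
        simp only [corner, wordMatrix_cons, Matrix.mul_add, Matrix.add_mul, Matrix.mul_assoc,
          add_assoc]
      _ = dirMatrix k' * ((1 - dirMatrix 3) * corner e + dirMatrix 3 * wordMatrix e) := by
        rw [hcoeff, hshift, Matrix.mul_add, Matrix.mul_assoc, Matrix.mul_assoc]
      _ = dirMatrix k'' * secondMatrix := by rw [hk, ← Matrix.mul_assoc, hk'']

theorem exists_headCoeff_sub_lastCoeff : ∀ i : Fin 8, ∃ k,
    (headCoeff (i + 1)).1 - (lastCoeff i).1 = dirMatrix k * (1 - dirMatrix 3) ∧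
    (headCoeff (i + 1)).2 - (lastCoeff i).2 = dirMatrix k * dirMatrix 3 := by decide

theorem secondMove_pathLast_pathHead (e : List Lifting) (i : Fin 8) :
    SecondMove (pathLast e i) (pathHead e (i + 1)) := by
  obtain ⟨k, h₁, h₂⟩ := exists_headCoeff_sub_lastCoeff i
  obtain ⟨k', hk'⟩ := exists_corner_eq_dirMatrix_mul e
  obtain ⟨k'', hk''⟩ := exists_dirMatrix_mul k k'
  refine ⟨k'', ?_⟩
  rw [← hk'', Matrix.mul_assoc, ← hk', Matrix.mul_add, ← Matrix.mul_assoc, ← Matrix.mul_assoc,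
    ← h₁, ← h₂, pathHead, pathLast, Matrix.sub_mul, Matrix.sub_mul]
  abel

theorem isChain_formalPaths (e : List Lifting) (i : Fin 8) :
    (formalPaths e i).IsChain SecondMove := by
  induction e generalizing i with
  | nil => exact List.isChain_singleton _
  | cons c e ih =>
    exact (List.isChain_map _).2 ((Lifting.isChain_combine SecondMove.symm (head?_formalPaths e)
      (getLast?_formalPaths e) ih (secondMove_pathLast_pathHead e) c i).imp
        fun _ _ h => h.add_right _)

theorem CycNext.secondMove (h : CycNext (formalCycle e) P Q) : SecondMove P Q := by
  rcases h.flatten_cases (formalPaths_ne_nil e) (formalCycle_nodup e) with ⟨i, hi⟩ | ⟨i, hP, hQ⟩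
  · exact List.isChain_pair.1 ((isChain_formalPaths e i).infix hi)
  · obtain rfl := Option.some_inj.1 ((getLast?_formalPaths e i).symm.trans hP)
    obtain rfl := Option.some_inj.1 ((head?_formalPaths e _).symm.trans hQ)
    exact secondMove_pathLast_pathHead e i

end SecondMove

/-! ### Squares with a common side -/

/-- The squares that the formal squares `P` and `Q` stand for in the frame lifted from the
`(1, 2)`-frame have a side in common. There the second leaper is the `(0, 1)`-leaper. -/
def SharesSide (P Q : FormalSquare) : Prop := ∃ k, act (Q - P) (1, 2) = act (dirMatrix k) (0, 1)

section SharesSide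

variable {m n s s' x x' : ℤ} {a b : Square} {c : Lifting} {e : List Lifting} {i j k : Fin 8}
  {P P' Q : FormalSquare}

theorem SharesSide.symm (h : SharesSide P Q) : SharesSide Q P := by
  obtain ⟨k, hk⟩ := h
  exact ⟨k + 4, by rw [← neg_sub, act_neg, hk, dirMatrix_add_four, act_neg]⟩

theorem sharesSide_liftSquare_iff :
    SharesSide (c.liftSquare e i P) (c.liftSquare e i Q) ↔ SharesSide P Q := by
  simp only [SharesSide, Lifting.liftSquare, add_sub_add_right_eq_sub]

theorem not_sharesSide_self (P : FormalSquare) : ¬SharesSide P P := by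
  rw [SharesSide, sub_self]
  decide

theorem SecondMove.sharesSide (h : SecondMove P Q) : SharesSide P Q := by
  obtain ⟨k, rfl⟩ := h
  refine ⟨k, ?_⟩
  rw [add_sub_cancel_left, act_mul]
  rfl

theorem InBand.eq_or_sub_eq (hs : IsSign s) (hs' : IsSign s') (hmn : m < n) (h : InBand m n s x)
    (h' : InBand m n s' x') (hx : IsSign (x' - x)) : s' = s ∨ s' - s = x' - x := by
  unfold IsSign at hx
  rcases hs with rfl | rfl | rfl <;> rcases hs' with rfl | rfl | rfl <;>
    simp only [inBand_zero, inBand_one, inBand_neg_one] at h h' <;> omega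

theorem isSign_act_dirMatrix_zero_one : ∀ k, IsSign (act (dirMatrix k) (0, 1)).1 ∧
    IsSign (act (dirMatrix k) (0, 1)).2 := by
  unfold IsSign
  decide

theorem eq_or_adjacent_of_octVec_sub : ∀ i j k : Fin 8,
    ((octVec 1 1 j).1 = (octVec 1 1 i).1 ∨
      (octVec 1 1 j).1 - (octVec 1 1 i).1 = (act (dirMatrix k) (0, 1)).1) →
    ((octVec 1 1 j).2 = (octVec 1 1 i).2 ∨
      (octVec 1 1 j).2 - (octVec 1 1 i).2 = (act (dirMatrix k) (0, 1)).2) →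
    i = j ∨ ((j = i + 1 ∨ i = j + 1) ∧
      act (dirMatrix k) (0, 1) = octVec 1 1 j - octVec 1 1 i) := by decide

theorem eq_or_adjacent_of_sub_eq (hmn : m < n) (ha : a ∈ frameSection m n i)
    (hb : b ∈ frameSection m n j) (hk : b - a = act (dirMatrix k) (0, 1)) :
    i = j ∨ ((j = i + 1 ∨ i = j + 1) ∧ b - a = octVec 1 1 j - octVec 1 1 i) := by
  have hsign := isSign_act_dirMatrix_zero_one k
  have hcases := eq_or_adjacent_of_octVec_sub i j k
  rw [← hk] at hsign hcases
  exact hcases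
    (ha.1.eq_or_sub_eq (isSign_octVec i).1 (isSign_octVec j).1 hmn hb.1 hsign.1)
    (ha.2.eq_or_sub_eq (isSign_octVec i).2 (isSign_octVec j).2 hmn hb.2 hsign.2)

theorem evalAt_sub_evalAt (x : ℤ × ℤ) (t : Square) (P Q : FormalSquare) :
    evalAt x t Q - evalAt x t P = act (Q - P) x := by
  rw [evalAt, evalAt, act_sub, add_sub_add_right_eq_sub]

theorem SharesSide.section_cases (hP : P ∈ formalPaths e i) (hQ : Q ∈ formalPaths e j)
    (h : SharesSide P Q) :
    i = j ∨ ((j = i + 1 ∨ i = j + 1) ∧ act (Q - P) (1, 2) = octVec 1 1 j - octVec 1 1 i) := by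
  obtain ⟨k, hk⟩ := h
  rw [← evalAt_sub_evalAt (1, 2) 0] at hk ⊢
  exact eq_or_adjacent_of_sub_eq (isFrame_act_wordMatrix e isShellOffset_one_two.isFrame).2
    (evalAt_mem_frameSection isShellOffset_one_two hP)
    (evalAt_mem_frameSection isShellOffset_one_two hQ) hk

theorem SharesSide.eq_of_mem_formalPaths (hij : i ≠ j) (hP : P ∈ formalPaths e i)
    (hP' : P' ∈ formalPaths e i) (hQ : Q ∈ formalPaths e j) (h : SharesSide P Q)
    (h' : SharesSide P' Q) : P = P' := by
  have hPQ := ((h.section_cases hP hQ).resolve_left hij).2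
  have hPQ' := ((h'.section_cases hP' hQ).resolve_left hij).2
  rw [← evalAt_sub_evalAt (1, 2) 0] at hPQ hPQ'
  exact evalAt_injOn isShellOffset_one_two e ⟨i, hP⟩ ⟨i, hP'⟩
    (sub_right_injective (hPQ.trans hPQ'.symm))

end SharesSide

namespace Lifting

variable {s s' y : ℤ} {x : ℤ × ℤ} {i j : Fin 8} {a : Square}

theorem two_mul_abs_add_sub_lt (c : Lifting) (hj : c.reverses j = false) (hx : IsFrame x)
    (hs : IsSign s) (hs' : IsSign s') (hodd : j.val % 2 = 1 → s ≠ 0)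
    (heven : j.val % 2 = 0 → s = 0 ∨ s' = s) (hy : 2 * |y| < x.1 + x.2)
    (h : InBand (c.frame x).1 (c.frame x).2 s (y + s * c.shift j x))
    (h' : InBand (c.frame x).1 (c.frame x).2 s' (y + s * c.shift j x + (s' - s))) :
    2 * |y + (s' - s)| < x.1 + x.2 := by
  obtain ⟨hpos, hlt⟩ := hx
  rw [two_mul_abs_lt_iff] at hy ⊢
  rcases Nat.mod_two_eq_zero_or_one j.val with h2 | h2 <;>
    cases c <;> simp [h2, reverses] at hj hodd heven <;>
    rcases hs with rfl | rfl | rfl <;> rcases hs' with rfl | rfl | rfl <;>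
    simp [h2, shift, frame, inBand_zero, inBand_one, inBand_neg_one] at * <;>
    omega

theorem octVec_eq_zero_or_eq_of_even : ∀ i j : Fin 8, (j = i + 1 ∨ i = j + 1) → j.val % 2 = 0 →
    ((octVec 1 1 j).1 = 0 ∨ (octVec 1 1 i).1 = (octVec 1 1 j).1) ∧
      ((octVec 1 1 j).2 = 0 ∨ (octVec 1 1 i).2 = (octVec 1 1 j).2) := by decide

-- An unreversed section is bordered by old squares that stay on the board.
theorem add_octVec_sub_mem_board (c : Lifting) (hij : j = i + 1 ∨ i = j + 1)
    (hj : c.reverses j = false) (hx : IsFrame x) (ha : a ∈ board x.1 x.2)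
    (h : a + c.translation x j ∈ frameSection (c.frame x).1 (c.frame x).2 j)
    (h' : a + c.translation x j + (octVec 1 1 i - octVec 1 1 j) ∈
      frameSection (c.frame x).1 (c.frame x).2 i) :
    a + (octVec 1 1 i - octVec 1 1 j) ∈ board x.1 x.2 := by
  rw [translation_eq_shift] at h h'
  exact ⟨c.two_mul_abs_add_sub_lt hj hx (isSign_octVec j).1 (isSign_octVec i).1
      (fun hmod => (octVec_ne_zero_of_odd j hmod).1)
      (fun hmod => (octVec_eq_zero_or_eq_of_even i j hij hmod).1) ha.1 h.1 h'.1,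
    c.two_mul_abs_add_sub_lt hj hx (isSign_octVec j).2 (isSign_octVec i).2
      (fun hmod => (octVec_ne_zero_of_odd j hmod).2)
      (fun hmod => (octVec_eq_zero_or_eq_of_even i j hij hmod).2) ha.2 h.2 h'.2⟩

end Lifting

section AreNeighbours

variable {α β : Type*} {l l' : List α} {x y : α}

/-- The entries `x` and `y` of the list `l` are next to each other, in either order. -/
def AreNeighbours (l : List α) (x y : α) : Prop := [x, y] <:+: l ∨ [y, x] <:+: l

theorem AreNeighbours.symm (h : AreNeighbours l x y) : AreNeighbours l y x := Or.symm h

theorem AreNeighbours.reverse (h : AreNeighbours l x y) : AreNeighbours l.reverse x y :=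
  h.symm.imp List.reverse_infix.2 List.reverse_infix.2

theorem AreNeighbours.of_infix (h : AreNeighbours l x y) (hl : l <:+: l') : AreNeighbours l' x y :=
  h.imp (·.trans hl) (·.trans hl)

theorem AreNeighbours.map (h : AreNeighbours l x y) (φ : α → β) :
    AreNeighbours (l.map φ) (φ x) (φ y) :=
  h.imp (fun h => h.map φ) fun h => h.map φ

theorem areNeighbours_append (hx : x ∈ l.getLast?) (hy : y ∈ l'.head?) :
    AreNeighbours (l ++ l') x y := by
  rw [← List.dropLast_append_getLast? x hx, ← List.cons_head?_tail hy]
  exact .inl ⟨l.dropLast, l'.tail, by simp⟩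

theorem AreNeighbours.cycAdj_flatten {L : List (List α)} (hl : l ∈ L) (h : AreNeighbours l x y) :
    CycAdj L.flatten x y :=
  h.imp (CycNext.flatten_of_infix hl) (CycNext.flatten_of_infix hl)

theorem isInfix_flatMap (φ : α → List β) (h : l <:+: l') : l.flatMap φ <:+: l'.flatMap φ := by
  obtain ⟨s, t, rfl⟩ := h
  exact ⟨s.flatMap φ, t.flatMap φ, by simp⟩

end AreNeighbours

namespace Lifting

variable {α : Type*} {a : Fin 8 → List α} {i j : Fin 8} {x y : α}

theorem isInfix_sources_of_add_one_mem (c : Lifting) : ∀ i j, j ∈ c.sources i →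
    j + 1 ∈ c.sources i →
    if c.reverses i then [j + 1, j] <:+: c.sources i else [j, j + 1] <:+: c.sources i := by
  cases c <;> decide

theorem areNeighbours_combine (c : Lifting) (hj : j ∈ c.sources i) (h : AreNeighbours (a j) x y) :
    AreNeighbours (c.combine a i) x y := by
  obtain ⟨s, t, hst⟩ := List.append_of_mem hj
  have hinfix : [j] <:+: c.sources i := ⟨s, t, by rw [hst, List.append_assoc]; rfl⟩
  refine AreNeighbours.of_infix ?_ (isInfix_flatMap _ hinfix)
  rw [List.flatMap_singleton]
  split_ifs
  exacts [h.reverse, h]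

theorem areNeighbours_combine_junction (c : Lifting) (hj : j ∈ c.sources i)
    (hj' : j + 1 ∈ c.sources i) (hx : x ∈ (a j).getLast?) (hy : y ∈ (a (j + 1)).head?) :
    AreNeighbours (c.combine a i) x y := by
  have hinfix := c.isInfix_sources_of_add_one_mem i j hj hj'
  unfold combine
  split_ifs at hinfix ⊢ with hi
  · refine AreNeighbours.of_infix (AreNeighbours.symm ?_) (isInfix_flatMap _ hinfix)
    simp only [List.flatMap_cons, List.flatMap_nil, List.append_nil]
    exact areNeighbours_append (by rwa [List.getLast?_reverse]) (by rwa [List.head?_reverse])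
  · refine AreNeighbours.of_infix ?_ (isInfix_flatMap _ hinfix)
    simp only [List.flatMap_cons, List.flatMap_nil, List.append_nil]
    exact areNeighbours_append hx hy

theorem reverses_of_adjacent (c : Lifting) : ∀ i j : Fin 8, (j = i + 1 ∨ i = j + 1) →
    (c.reverses i = true ∧ c.reverses j = false) ∨
      (c.reverses j = true ∧ c.reverses i = false) := by
  cases c <;> decide

/-- The square of the `i`-th section which borders the copy in the `j`-th section of a square `Q`
of a source `j₀` is a copy of a square `P`. If the first leaper reaches `P` by a move of direction
`k`, then `P` lies in another section than `Q`, and if the section of `P` is adjacent to that of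
`Q`, then the copy of the junction of the two is a junction of the `i`-th and `j`-th sections. -/
def CrossesBy (c : Lifting) (i j k : Fin 8) : Prop :=
  c.translationMatrix i = dirMatrix k + c.translationMatrix j ∧
  ∀ j₀ ∈ c.sources j, ∀ j₁, (j₁ = k ∨ j₁ = k + 1) → j₁ ≠ j₀ ∧
    (j₀ = j₁ + 1 → j = i + 1 ∧ j₀ ∈ (c.sources j).head?) ∧
    (j₁ = j₀ + 1 → i = j + 1 ∧ j₀ ∈ (c.sources j).getLast?)

instance (c : Lifting) (i j k : Fin 8) : Decidable (c.CrossesBy i j k) :=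
  inferInstanceAs (Decidable (_ ∧ _))

theorem exists_crossesBy (c : Lifting) : ∀ i j, c.reverses i = true → c.reverses j = false →
    (j = i + 1 ∨ i = j + 1) → ∃ k, c.CrossesBy i j k := by
  cases c <;> decide

theorem CrossesBy.liftSquare {c : Lifting} {k : Fin 8} (h : c.CrossesBy i j k) (e : List Lifting)
    (P : FormalSquare) :
    c.liftSquare e i P = c.liftSquare e j (P + dirMatrix k * wordMatrix e) := by
  unfold Lifting.liftSquare
  rw [h.1, Matrix.add_mul, add_assoc]

end Lifting

section SecondCoherence

variable {c : Lifting} {e : List Lifting} {i j i₀ j₀ : Fin 8} {P Q : FormalSquare}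

theorem cycAdj_pathLast_pathHead (e : List Lifting) (i : Fin 8) :
    CycAdj (formalCycle e) (pathLast e i) (pathHead e (i + 1)) :=
  .inl (CycNext.flatten_of_junction (cycNext_ofFn (n := 6) (formalPaths e) i)
    (getLast?_formalPaths e i) (head?_formalPaths e (i + 1)))

theorem CycNext.formalCycle_cases (hP : P ∈ formalPaths e i) (hQ : Q ∈ formalPaths e j)
    (h : CycNext (formalCycle e) P Q) : (i = j ∧ [P, Q] <:+: formalPaths e i) ∨
      (j = i + 1 ∧ P = pathLast e i ∧ Q = pathHead e j) := by
  rcases h.flatten_cases (formalPaths_ne_nil e) (formalCycle_nodup e) with ⟨l, hl⟩ | ⟨l, hlP, hlQ⟩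
  · obtain rfl := formalPaths_section_unique hP (hl.subset (by simp))
    exact .inl ⟨formalPaths_section_unique (hl.subset (by simp)) hQ, hl⟩
  · obtain rfl := formalPaths_section_unique hP (List.mem_of_getLast? hlP)
    obtain rfl := formalPaths_section_unique hQ (List.mem_of_head? hlQ)
    rw [getLast?_formalPaths] at hlP
    rw [head?_formalPaths] at hlQ
    exact .inr ⟨rfl, (Option.some_inj.1 hlP).symm, (Option.some_inj.1 hlQ).symm⟩

theorem CycNext.cycAdj_liftSquare (hi₀ : i₀ ∈ c.sources i) (hj₀ : j₀ ∈ c.sources i)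
    (hP : P ∈ formalPaths e i₀) (hQ : Q ∈ formalPaths e j₀) (h : CycNext (formalCycle e) P Q) :
    CycAdj (formalCycle (c :: e)) (c.liftSquare e i P) (c.liftSquare e i Q) := by
  refine AreNeighbours.cycAdj_flatten ((List.mem_ofFn' _ _).2 ⟨i, rfl⟩) (AreNeighbours.map ?_ _)
  rcases h.formalCycle_cases hP hQ with ⟨-, hPQ⟩ | ⟨rfl, rfl, rfl⟩
  · exact c.areNeighbours_combine hi₀ (.inl hPQ)
  · exact c.areNeighbours_combine_junction hi₀ hj₀ (getLast?_formalPaths e _)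
      (head?_formalPaths e _)

theorem CycAdj.liftSquare (hi₀ : i₀ ∈ c.sources i) (hj₀ : j₀ ∈ c.sources i)
    (hP : P ∈ formalPaths e i₀) (hQ : Q ∈ formalPaths e j₀) (h : CycAdj (formalCycle e) P Q) :
    CycAdj (formalCycle (c :: e)) (c.liftSquare e i P) (c.liftSquare e i Q) := by
  rcases h with h | h
  exacts [h.cycAdj_liftSquare hi₀ hj₀ hP hQ, (h.cycAdj_liftSquare hj₀ hi₀ hQ hP).symm]

theorem evalAt_mem_board_of_sharesSide (hij : j = i + 1 ∨ i = j + 1) (hj : c.reverses j = false)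
    (hj₀ : j₀ ∈ c.sources j) (hP : c.liftSquare e j P ∈ formalPaths (c :: e) i)
    (hQ : Q ∈ formalPaths e j₀) (h : SharesSide P Q) :
    evalAt (1, 2) 0 P ∈ board (act (wordMatrix e) (1, 2)).1 (act (wordMatrix e) (1, 2)).2 := by
  have hframe := isFrame_act_wordMatrix (x := (1, 2)) e isShellOffset_one_two.isFrame
  have hlift := liftSquare_mem_formalPaths hQ hj₀
  have hne : j ≠ i := fun hji => by simp [hji] at hij
  have hsub : evalAt (1, 2) 0 P = evalAt (1, 2) 0 Q + (octVec 1 1 i - octVec 1 1 j) := by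
    rw [← (((sharesSide_liftSquare_iff.2 h.symm).section_cases hlift hP).resolve_left hne).2,
      ← evalAt_sub_evalAt (1, 2) 0, evalAt_liftSquare, evalAt_liftSquare,
      add_sub_add_right_eq_sub, add_sub_cancel]
  have hboard := frameSection_subset_board hframe.1 hframe.2 _
    (evalAt_mem_frameSection (x := (1, 2)) isShellOffset_one_two hQ)
  have hQsec := evalAt_mem_frameSection (x := (1, 2)) isShellOffset_one_two hlift
  have hPsec := evalAt_mem_frameSection (x := (1, 2)) isShellOffset_one_two hP
  rw [evalAt_liftSquare, wordMatrix_cons, act_mul, ← c.frame_eq_act] at hQsec hPsec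
  rw [hsub, add_right_comm] at hPsec
  exact hsub ▸ c.add_octVec_sub_mem_board hij hj hframe hboard hQsec hPsec

theorem exists_eq_liftSquare_of_sharesSide (hi : c.reverses i = true) (hj : c.reverses j = false)
    (hij : j = i + 1 ∨ i = j + 1) (hj₀ : j₀ ∈ c.sources j) (hP : P ∈ formalPaths (c :: e) i)
    (hQ : Q ∈ formalPaths e j₀) (h : SharesSide P (c.liftSquare e j Q)) :
    ∃ j₁, ∃ P₁ ∈ formalPaths e j₁, P = c.liftSquare e j P₁ ∧ j₁ ≠ j₀ ∧
      (j₀ = j₁ + 1 → j = i + 1 ∧ j₀ ∈ (c.sources j).head?) ∧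
      (j₁ = j₀ + 1 → i = j + 1 ∧ j₀ ∈ (c.sources j).getLast?) := by
  have hframe := isFrame_act_wordMatrix (x := (1, 2)) e isShellOffset_one_two.isFrame
  obtain ⟨k, hk⟩ := c.exists_crossesBy i j hi hj hij
  obtain ⟨i₀, -, P₀, hP₀, rfl⟩ := mem_formalPaths_cons.1 hP
  rw [hk.liftSquare] at hP h ⊢
  have hboard := evalAt_mem_board_of_sharesSide hij hj hj₀ hP hQ (sharesSide_liftSquare_iff.1 h)
  have hdir := (moveDir_evalAt (1, 2) 0 rfl).eq_add_three_or_four hframe.2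
    (evalAt_mem_frameSection isShellOffset_one_two hP₀) hboard
  obtain ⟨j₁, hj₁, hP₁⟩ := exists_add_move_mem_formalPaths hP₀ hdir
  exact ⟨j₁, _, hP₁, rfl, hk.2 j₀ hj₀ j₁ hj₁.2⟩

theorem cycAdj_of_sharesSide_of_reverses
    (ih : ∀ {P Q}, P ∈ formalSquares e → Q ∈ formalSquares e → SharesSide P Q →
      CycAdj (formalCycle e) P Q)
    (hi : c.reverses i = true) (hj : c.reverses j = false) (hij : j = i + 1 ∨ i = j + 1)
    (hP : P ∈ formalPaths (c :: e) i) (hQ : Q ∈ formalPaths (c :: e) j) (h : SharesSide P Q) :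
    CycAdj (formalCycle (c :: e)) P Q := by
  have hne : i ≠ j := fun hij' => by simp [hij'] at hij
  obtain ⟨j₀, hj₀, Q₀, hQ₀, rfl⟩ := mem_formalPaths_cons.1 hQ
  obtain ⟨j₁, P₁, hP₁, rfl, hne', hhead, hlast⟩ :=
    exists_eq_liftSquare_of_sharesSide hi hj hij hj₀ hP hQ₀ h
  rcases ih ⟨j₁, hP₁⟩ ⟨j₀, hQ₀⟩ (sharesSide_liftSquare_iff.1 h) with hadj | hadj
  · obtain ⟨h₁, -⟩ | ⟨h₁, -, rfl⟩ := hadj.formalCycle_cases hP₁ hQ₀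
    · exact absurd h₁ hne'
    obtain ⟨rfl, hmem⟩ := hhead h₁
    have hQ' : pathHead (c :: e) (i + 1) = c.liftSquare e (i + 1) (pathHead e j₀) := by
      rw [pathHead_cons hmem, if_neg (by simp [hj])]
    rw [← hQ'] at hQ h ⊢
    rw [h.eq_of_mem_formalPaths hne hP (pathLast_mem_formalPaths _ _) hQ
      (secondMove_pathLast_pathHead _ _).sharesSide]
    exact cycAdj_pathLast_pathHead _ _
  · obtain ⟨h₁, -⟩ | ⟨h₁, rfl, -⟩ := hadj.formalCycle_cases hQ₀ hP₁
    · exact absurd h₁.symm hne'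
    obtain ⟨rfl, hmem⟩ := hlast h₁
    have hQ' : pathLast (c :: e) j = c.liftSquare e j (pathLast e j₀) := by
      rw [pathLast_cons hmem, if_neg (by simp [hj])]
    rw [← hQ'] at hQ h ⊢
    rw [h.eq_of_mem_formalPaths hne hP (pathHead_mem_formalPaths _ _) hQ
      (secondMove_pathLast_pathHead _ _).symm.sharesSide]
    exact (cycAdj_pathLast_pathHead _ _).symm

theorem cycAdj_of_sharesSide (hP : P ∈ formalSquares e) (hQ : Q ∈ formalSquares e)
    (h : SharesSide P Q) : CycAdj (formalCycle e) P Q := by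
  induction e generalizing P Q with
  | nil =>
    obtain ⟨i, hP⟩ := hP
    obtain ⟨j, hQ⟩ := hQ
    have hcases := h.section_cases hP hQ
    obtain rfl := mem_formalPaths_nil.1 hP
    obtain rfl := mem_formalPaths_nil.1 hQ
    obtain rfl | ⟨rfl | rfl, -⟩ := hcases
    · exact absurd h (not_sharesSide_self _)
    · simpa only [pathLast_nil, pathHead_nil] using cycAdj_pathLast_pathHead [] i
    · simpa only [pathLast_nil, pathHead_nil] using (cycAdj_pathLast_pathHead [] j).symm
  | cons c e ih =>
    obtain ⟨i, hP⟩ := hP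
    obtain ⟨j, hQ⟩ := hQ
    obtain rfl | ⟨hij, -⟩ := h.section_cases hP hQ
    · obtain ⟨i₀, hi₀, P₀, hP₀, rfl⟩ := mem_formalPaths_cons.1 hP
      obtain ⟨j₀, hj₀, Q₀, hQ₀, rfl⟩ := mem_formalPaths_cons.1 hQ
      exact (ih ⟨i₀, hP₀⟩ ⟨j₀, hQ₀⟩ (sharesSide_liftSquare_iff.1 h)).liftSquare hi₀ hj₀ hP₀ hQ₀
    · obtain ⟨hi, hj⟩ | ⟨hj, hi⟩ := c.reverses_of_adjacent i j hij
      · exact cycAdj_of_sharesSide_of_reverses ih hi hj hij hP hQ h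
      · exact (cycAdj_of_sharesSide_of_reverses ih hj hi hij.symm hQ hP h.symm).symm

end SecondCoherence

/-! ### The cycles of the two leapers -/

section FirstLeaper

variable {x : ℤ × ℤ} {t : Square} {e : List Lifting} {P Q : FormalSquare}

theorem evalAt_mem_board (ht : IsShellOffset x.1 x.2 t) (hP : P ∈ formalSquares e) :
    evalAt x t P ∈ board (act (wordMatrix e) x).1 (act (wordMatrix e) x).2 := by
  obtain ⟨i, hi⟩ := hP
  have ⟨hpos, hlt⟩ := isFrame_act_wordMatrix e ht.isFrame
  exact frameSection_subset_board hpos hlt i (evalAt_mem_frameSection ht hi)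

theorem finite_formalSquares (e : List Lifting) : (formalSquares e).Finite :=
  (List.finite_toSet (formalCycle e)).subset fun _ => mem_formalCycle.2

theorem nonempty_formalSquares (e : List Lifting) : (formalSquares e).Nonempty :=
  ⟨pathHead e 0, 0, pathHead_mem_formalPaths e 0⟩

theorem exists_isLeaperCycle (ht : IsShellOffset x.1 x.2 t) (e : List Lifting) :
    ∃ C, IsLeaperCycle (act (wordMatrix e) x).1 (act (wordMatrix e) x).2 C ∧
      vertexSet C = evalAt x t '' formalSquares e := by
  have := (finite_formalSquares e).to_subtype
  have := (nonempty_formalSquares e).to_subtype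
  obtain ⟨l, hnd, h3, hmem, hadj⟩ :=
    exists_hamiltonian_cycle (ncard_neighborSet_moveGraph e) (preconnected_moveGraph e)
  have hinj : Function.Injective fun P : formalSquares e => evalAt x t P.1 :=
    (evalAt_injOn ht e).injective
  refine ⟨l.map fun P => evalAt x t P.1, ⟨hnd.map hinj, by rwa [List.length_map], ?_⟩, ?_⟩
  · intro a b hab
    obtain ⟨P, Q, rfl, rfl, hPQ⟩ := CycNext.of_map hab
    exact (hadj P Q hPQ).imp fun k => moveDir_evalAt x t
  · ext a
    simp only [vertexSet, List.mem_map, hmem, true_and, Set.mem_ofPred_eq, Subtype.exists,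
      Set.mem_image, exists_prop]

theorem exists_isShellCycle {m n : ℤ} (ht : IsShellOffset m n t) :
    ∃ C, IsShellCycle m n C ∧ vertexSet C = Set.range fun i => octVec (n - m) m i + t := by
  obtain ⟨C, hC, hv⟩ := exists_isLeaperCycle (x := (m, n)) ht []
  have hrange : vertexSet C = Set.range fun i => octVec (n - m) m i + t := by
    rw [hv]
    ext a
    simp [formalSquares, mem_formalPaths_nil, evalAt_shellSquare]
  rw [show wordMatrix [] = 1 from rfl, act_one] at hC
  refine ⟨C, ⟨hC, ?_⟩, hrange⟩
  rw [hrange]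
  rintro _ ⟨i, rfl⟩
  exact mem_shell_iff.2 ⟨i, by rwa [add_sub_cancel_left]⟩

theorem exists_isFundamentalCycle (e : List Lifting) :
    ∃ (V : Type u) (Φ : LabeledDigraph V), IsFundamentalCycle e Φ := by
  obtain ⟨C, hC, hv⟩ := exists_isLeaperCycle (x := proportions []) isShellOffset_one_two e
  obtain ⟨C₀, hC₀, hv₀⟩ := exists_isShellCycle isShellOffset_one_two
  have hboard : vertexSet C ⊆ board _ _ :=
    hv ▸ Set.image_subset_iff.2 fun P => evalAt_mem_board isShellOffset_one_two
  rw [← proportions_append] at hC hboard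
  obtain ⟨V, Φ, hΦ⟩ := exists_isExtractedFrom _ _ C
  refine ⟨V, Φ, _, _, C, isSkewBasic_proportions (e ++ []), ⟨hC, hboard⟩,
    ⟨[], rfl, C₀, hC₀, ?_⟩, hΦ⟩
  rw [hv₀, hv]
  exact (liftSets_eq_image (d := []) (t := 0) isShellOffset_one_two e).symm

theorem cycAdj_and_moveDir_evalAt_iff {C : List Square} {i : Fin 8} (ht : IsShellOffset x.1 x.2 t)
    (hC : IsLeaperCycle (act (wordMatrix e) x).1 (act (wordMatrix e) x).2 C)
    (hv : vertexSet C = evalAt x t '' formalSquares e) (hP : P ∈ formalSquares e)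
    (hQ : Q ∈ formalSquares e) :
    CycAdj C (evalAt x t P) (evalAt x t Q) ∧
        MoveDir (act (wordMatrix e) x).1 (act (wordMatrix e) x).2 i (evalAt x t P) (evalAt x t Q) ↔
      P + dirMatrix i * wordMatrix e = Q := by
  obtain ⟨j, hj⟩ := hP
  have hlt := (isFrame_act_wordMatrix e ht.isFrame).2
  have hPj := evalAt_mem_frameSection ht hj
  have hboard : vertexSet C ⊆ board _ _ :=
    hv ▸ Set.image_subset_iff.2 fun P => evalAt_mem_board ht
  constructor
  · rintro ⟨-, hmove⟩
    obtain ⟨j', -, hj'⟩ := exists_add_move_mem_formalPaths hj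
      (hmove.eq_add_three_or_four hlt hPj (evalAt_mem_board ht hQ))
    exact evalAt_injOn ht e ⟨j', hj'⟩ hQ ((moveDir_evalAt x t rfl).right_unique hmove)
  · intro h
    have hmove := moveDir_evalAt x t h
    have hPC : evalAt x t P ∈ vertexSet C := hv ▸ Set.mem_image_of_mem _ ⟨j, hj⟩
    exact ⟨hC.cycAdj_of_moveDir hlt hboard hPC hPj (evalAt_mem_board ht hQ) hmove, hmove⟩

theorem IsFundamentalCycle.exists_isPositioned {V : Type*} {Φ : LabeledDigraph V}
    (hΦ : IsFundamentalCycle e Φ) : Φ.IsCycleGraph ∧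
      ∃ pos, Set.range pos = formalSquares e ∧ Φ.IsPositioned pos (wordMatrix e)⁻¹ := by
  obtain ⟨p, q, C, -, ⟨hC, -⟩, ⟨d, hpq, C₀, hC₀, hv⟩, hΦ⟩ := hΦ
  obtain ⟨t, ht, hv₀⟩ := hC₀.exists_offset
  rw [hv₀, liftSets_eq_image ht] at hv
  obtain ⟨rfl, rfl⟩ := Prod.ext_iff.1 ((proportions_append e d).symm.trans hpq)
  have hdet := (Matrix.isUnit_iff_isUnit_det _).1 (isUnit_wordMatrix e)
  refine ⟨hΦ.isCycleGraph hC, hΦ.exists_isPositioned (evalAt_injOn ht e) hv.symm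
    (Matrix.isUnit_nonsing_inv_iff.2 (isUnit_wordMatrix e)) fun P hP Q hQ i => ?_⟩
  rw [cycAdj_and_moveDir_evalAt_iff ht hC hv hP hQ, ← eq_sub_iff_add_eq', eq_comm]
  constructor <;> intro h
  · rw [h, Matrix.mul_nonsing_inv_cancel_right _ _ hdet]
  · rw [← h, Matrix.nonsing_inv_mul_cancel_right _ _ hdet]

end FirstLeaper

section SecondLeaper

variable {x y : ℤ × ℤ} {t : Square} {e : List Lifting} {o : Lifting} {P Q : FormalSquare}

theorem vertexSet_map_evalAt (x : ℤ × ℤ) (t : Square) (e : List Lifting) :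
    vertexSet ((formalCycle e).map (evalAt x t)) = evalAt x t '' formalSquares e := by
  ext a
  simp only [vertexSet, List.mem_map, mem_formalCycle, Set.mem_ofPred_eq, Set.mem_image]

theorem nodup_map_evalAt (ht : IsShellOffset x.1 x.2 t) (e : List Lifting) :
    ((formalCycle e).map (evalAt x t)).Nodup :=
  List.Nodup.map_on (fun _ hP _ hQ => evalAt_injOn ht e (mem_formalCycle.1 hP)
    (mem_formalCycle.1 hQ)) (formalCycle_nodup e)

theorem three_le_length_formalCycle (e : List Lifting) : 3 ≤ (formalCycle e).length := by
  obtain ⟨C, hC, hv⟩ := exists_isLeaperCycle (x := (1, 2)) isShellOffset_one_two e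
  have hperm := (List.perm_ext_iff_of_nodup hC.1 (nodup_map_evalAt isShellOffset_one_two e)).2
    (Set.ext_iff.1 (hv.trans (vertexSet_map_evalAt _ _ e).symm))
  rw [← List.length_map, ← hperm.length_eq]
  exact hC.2.1

theorem flatten_liftCycles (d e : List Lifting) (t : Square) :
    (List.ofFn (liftCycles d e fun i =>
      [octVec ((proportions d).2 - (proportions d).1) (proportions d).1 i + t])).flatten =
    (formalCycle e).map (evalAt (proportions d) t) := by
  rw [liftCycles_eq_map, formalCycle, List.map_flatten, List.map_ofFn]
  rfl

theorem exists_isSecondFundamentalCycle (e : List Lifting) (ho : o = .g ∨ o = .h) :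
    ∃ (V : Type u) (Ψ : LabeledDigraph V), IsSecondFundamentalCycle e o Ψ := by
  have ht : IsShellOffset (proportions [o]).1 (proportions [o]).2 0 := by
    rcases ho with rfl | rfl <;> simp [IsShellOffset, proportions, Lifting.frame]
  obtain ⟨C, hC, hv⟩ := exists_isLeaperCycle ht e
  obtain ⟨C₀, hC₀, hv₀⟩ := exists_isShellCycle ht
  have hboard : vertexSet C ⊆ board _ _ :=
    hv ▸ Set.image_subset_iff.2 fun P => evalAt_mem_board ht
  rw [← proportions_append] at hC hboard
  obtain ⟨V, Ψ, hΨ⟩ := exists_isExtractedFrom (proportions []).1 (proportions []).2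
    ((formalCycle e).map (evalAt (proportions [o]) 0))
  refine ⟨V, Ψ, _, _, C, _, _, _, isSkewBasic_proportions (e ++ [o]), ⟨hC, hboard⟩,
    isSkewBasic_proportions [], ⟨[], rfl, rfl, C₀, _, hC₀, fun i => ⟨_, ht.mem_frameSection i, rfl⟩,
      ?_, (flatten_liftCycles [o] e 0).symm, ?_⟩, hΨ⟩
  · rw [hv₀]
    ext a
    simp only [vertexSet, List.mem_flatten, List.mem_ofFn', Set.mem_range,
      exists_exists_eq_and, List.mem_singleton, Set.mem_ofPred_eq, @eq_comm _ a]
  · rw [hv, vertexSet_map_evalAt]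

theorem secondMatrix_mul_matrix (ho : o = .g ∨ o = .h) :
    ∃ k, secondMatrix * o.matrix = dirMatrix k := by
  rcases ho with rfl | rfl <;> decide

theorem exists_matrix_mul_eq_one (ho : o = .g ∨ o = .h) :
    ∃ k, o.matrix * (dirMatrix k * secondMatrix) = 1 := by
  rcases ho with rfl | rfl <;> decide

theorem secondMove_iff (ho : o = .g ∨ o = .h) :
    SecondMove P Q ↔ ∃ k, (Q - P) * o.matrix = dirMatrix k := by
  constructor
  · rintro ⟨k, rfl⟩
    obtain ⟨k', hk'⟩ := secondMatrix_mul_matrix ho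
    obtain ⟨k'', hk''⟩ := exists_dirMatrix_mul k k'
    exact ⟨k'', by rw [add_sub_cancel_left, Matrix.mul_assoc, hk', hk'']⟩
  · rintro ⟨k, hk⟩
    obtain ⟨k', hk'⟩ := exists_matrix_mul_eq_one ho
    obtain ⟨k'', hk''⟩ := exists_dirMatrix_mul k k'
    refine ⟨k'', ?_⟩
    rw [← hk'', Matrix.mul_assoc, ← hk, Matrix.mul_assoc, hk', Matrix.mul_one, add_sub_cancel]

theorem cycAdj_formalCycle_iff (hP : P ∈ formalSquares e) (hQ : Q ∈ formalSquares e) :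
    CycAdj (formalCycle e) P Q ↔ SecondMove P Q :=
  ⟨fun h => h.elim CycNext.secondMove fun h => h.secondMove.symm,
    fun h => cycAdj_of_sharesSide hP hQ h.sharesSide⟩

theorem moveDir_evalAt_of_sub_mul_eq {k : Fin 8} (y : ℤ × ℤ) (t : Square)
    (h : (Q - P) * o.matrix = dirMatrix k) :
    MoveDir y.1 y.2 k (evalAt (act o.matrix y) t P) (evalAt (act o.matrix y) t Q) := by
  rw [moveDir_iff, ← h, act_mul, ← evalAt_add, add_sub_cancel]

theorem isLeaperCycle_map_evalAt (ho : o = .g ∨ o = .h)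
    (ht : IsShellOffset (act o.matrix y).1 (act o.matrix y).2 t) (e : List Lifting) :
    IsLeaperCycle y.1 y.2 ((formalCycle e).map (evalAt (act o.matrix y) t)) := by
  refine ⟨nodup_map_evalAt ht e, ?_, fun a b hab => ?_⟩
  · rw [List.length_map]
    exact three_le_length_formalCycle e
  · obtain ⟨P, Q, rfl, rfl, hPQ⟩ := CycNext.of_map hab
    exact ((secondMove_iff ho).1 hPQ.secondMove).imp fun k => moveDir_evalAt_of_sub_mul_eq y t

theorem cycAdj_and_moveDir_second_iff {k : Fin 8} (ho : o = .g ∨ o = .h) (hy : IsFrame y)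
    (ht : IsShellOffset (act o.matrix y).1 (act o.matrix y).2 t) (hP : P ∈ formalSquares e)
    (hQ : Q ∈ formalSquares e) :
    CycAdj ((formalCycle e).map (evalAt (act o.matrix y) t)) (evalAt (act o.matrix y) t P)
        (evalAt (act o.matrix y) t Q) ∧
      MoveDir y.1 y.2 k (evalAt (act o.matrix y) t P) (evalAt (act o.matrix y) t Q) ↔
    (Q - P) * o.matrix = dirMatrix k := by
  have hnext {P Q} (hP : P ∈ formalSquares e) (hQ : Q ∈ formalSquares e)
      (h : CycNext ((formalCycle e).map (evalAt (act o.matrix y) t))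
        (evalAt (act o.matrix y) t P) (evalAt (act o.matrix y) t Q)) : SecondMove P Q := by
    obtain ⟨P', Q', hP', hQ', h'⟩ := h.of_map
    obtain rfl := evalAt_injOn ht e (mem_formalCycle.1 h'.mem_left) hP hP'
    obtain rfl := evalAt_injOn ht e (mem_formalCycle.1 h'.mem_right) hQ hQ'
    exact h'.secondMove
  constructor
  · rintro ⟨hadj, hmove⟩
    have hPQ : SecondMove P Q := hadj.elim (hnext hP hQ) fun h => (hnext hQ hP h).symm
    obtain ⟨k', hk'⟩ := (secondMove_iff ho).1 hPQ
    rwa [hmove.dir_unique hy.1 hy.2 (moveDir_evalAt_of_sub_mul_eq y t hk')]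
  · intro hk
    exact ⟨((cycAdj_formalCycle_iff hP hQ).2 ((secondMove_iff ho).2 ⟨k, hk⟩)).map _,
      moveDir_evalAt_of_sub_mul_eq y t hk⟩

theorem eq_of_vertexSet_flatten_eq {m n : ℤ} {a : Fin 8 → List Square}
    (ht : IsShellOffset m n t) (ha : ∀ i, ∃ z ∈ frameSection m n i, a i = [z])
    (hv : vertexSet (List.ofFn a).flatten = Set.range fun i => octVec (n - m) m i + t) :
    a = fun i => [octVec (n - m) m i + t] := by
  funext i
  obtain ⟨z, hz, hzi⟩ := ha i
  have hzv : z ∈ vertexSet (List.ofFn a).flatten :=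
    List.mem_flatten.2 ⟨a i, (List.mem_ofFn' _ _).2 ⟨i, rfl⟩, by rw [hzi, List.mem_singleton]⟩
  rw [hv] at hzv
  obtain ⟨j, rfl⟩ := hzv
  rw [hzi, frameSection_unique ht.isFrame.2 hz (ht.mem_frameSection j)]

theorem IsSecondFundamentalCycle.exists_isPositioned {V : Type*} {Ψ : LabeledDigraph V}
    (ho : o = .g ∨ o = .h) (hΨ : IsSecondFundamentalCycle e o Ψ) : Ψ.IsCycleGraph ∧
      ∃ pos, Set.range pos = formalSquares e ∧ Ψ.IsPositioned pos o.matrix := by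
  obtain ⟨p, q, C, r, s, D, -, -, -, ⟨d, -, hrs, C₀, a, hC₀, ha, hv, hD, -⟩, hΨ⟩ := hΨ
  obtain ⟨t, ht, hv₀⟩ := hC₀.exists_offset
  obtain ⟨rfl, rfl⟩ := Prod.ext_iff.1 hrs
  rw [eq_of_vertexSet_flatten_eq ht ha (hv.trans hv₀), flatten_liftCycles] at hD
  have hact : proportions (o :: d) = act o.matrix (proportions d) := o.frame_eq_act _
  rw [hact] at ht hD
  subst hD
  exact ⟨hΨ.isCycleGraph (isLeaperCycle_map_evalAt ho ht e),
    hΨ.exists_isPositioned (evalAt_injOn ht e) (vertexSet_map_evalAt _ t e).symm o.isUnit_matrix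
      fun P hP Q hQ i => cycAdj_and_moveDir_second_iff ho (isFrame_proportions d) ht hP hQ⟩

end SecondLeaper

/-! ### The duality matrices -/

theorem three_lt_proportions_cons (c : Lifting) (e : List Lifting) :
    3 < (proportions (c :: e)).1 + (proportions (c :: e)).2 := by
  have ⟨hpos, hlt⟩ := isFrame_proportions e
  rw [proportions]
  cases c <;> simp only [Lifting.frame] <;> omega

theorem act_dirMatrix_sum_le : ∀ k,
    (act (dirMatrix k) (1, 2)).1 + (act (dirMatrix k) (1, 2)).2 ≤ 3 := by
  decide

theorem wordMatrix_mul_matrix_ne_dirMatrix (e : List Lifting) (o : Lifting) (k : Fin 8) :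
    wordMatrix e * o.matrix ≠ dirMatrix k := by
  intro h
  have hact : proportions (e ++ [o]) = act (dirMatrix k) (1, 2) := by
    rw [proportions_append, ← h, act_mul]
    exact congrArg _ (o.frame_eq_act (1, 2))
  have hlt : 3 < (proportions (e ++ [o])).1 + (proportions (e ++ [o])).2 := by
    cases e <;> exact three_lt_proportions_cons _ _
  rw [hact] at hlt
  exact hlt.not_ge (act_dirMatrix_sum_le k)

theorem realMatrix_inv {A : Matrix (Fin 2) (Fin 2) ℤ} (hA : IsUnit A) :
    realMatrix A⁻¹ = (realMatrix A)⁻¹ := by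
  refine (Matrix.inv_eq_right_inv ?_).symm
  rw [← realMatrix_mul, Matrix.mul_nonsing_inv _ ((Matrix.isUnit_iff_isUnit_det A).1 hA),
    realMatrix_one]

theorem realMatrix_wordMatrix_mul_matrix_ne (e : List Lifting) (o : Lifting) (k : Fin 8) :
    realMatrix (wordMatrix e * o.matrix) ≠ realMatrix (dirMatrix k) :=
  realMatrix_injective.ne (wordMatrix_mul_matrix_ne_dirMatrix e o k)

theorem realMatrix_inv_ne_dirMatrix (e : List Lifting) (o : Lifting) (k : Fin 8) :
    (realMatrix (wordMatrix e * o.matrix))⁻¹ ≠ realMatrix (dirMatrix k) := by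
  have hunit := (isUnit_wordMatrix e).mul o.isUnit_matrix
  obtain ⟨j, hj⟩ := exists_realMatrix_dirMatrix_inv k
  intro h
  refine realMatrix_wordMatrix_mul_matrix_ne e o j ?_
  rw [← hj, ← h, ← realMatrix_inv hunit, ← realMatrix_inv (Matrix.isUnit_nonsing_inv_iff.2 hunit),
    Matrix.nonsing_inv_nonsing_inv _ ((Matrix.isUnit_iff_isUnit_det _).1 hunit)]

theorem mainTheorem8 (e : List Lifting) (o : Lifting) (ho : o = Lifting.g ∨ o = Lifting.h) :
    (∃ (V : Type u) (Φ : LabeledDigraph V), IsFundamentalCycle e Φ) ∧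
    (∃ (V : Type u) (Ψ : LabeledDigraph V), IsSecondFundamentalCycle e o Ψ) ∧
    ∀ (V W : Type u) (Φ : LabeledDigraph V) (Ψ : LabeledDigraph W),
      IsFundamentalCycle e Φ → IsSecondFundamentalCycle e o Ψ →
        Φ.IsDual ∧ Ψ.IsDual ∧
        Ψ.IsDualWith Φ (realMatrix (wordMatrix e * o.matrix)) ∧
        Φ.IsDualWith Ψ (realMatrix (wordMatrix e * o.matrix))⁻¹ := by
  refine ⟨exists_isFundamentalCycle e, exists_isSecondFundamentalCycle e ho,
    fun V W Φ Ψ hΦ hΨ => ?_⟩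
  obtain ⟨hΦcycle, pos, hrange, hpos⟩ := hΦ.exists_isPositioned
  obtain ⟨hΨcycle, pos', hrange', hpos'⟩ := hΨ.exists_isPositioned ho
  have hscale : realMatrix o.matrix =
      realMatrix (wordMatrix e)⁻¹ * realMatrix (wordMatrix e * o.matrix) := by
    rw [← realMatrix_mul, Matrix.nonsing_inv_mul_cancel_left _ _
      ((Matrix.isUnit_iff_isUnit_det _).1 (isUnit_wordMatrix e))]
  have hscale' : realMatrix (wordMatrix e)⁻¹ =
      realMatrix o.matrix * (realMatrix (wordMatrix e * o.matrix))⁻¹ := by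
    rw [← realMatrix_inv ((isUnit_wordMatrix e).mul o.isUnit_matrix), ← realMatrix_mul,
      Matrix.mul_inv_rev, Matrix.mul_nonsing_inv_cancel_left _ _
      ((Matrix.isUnit_iff_isUnit_det _).1 o.isUnit_matrix)]
  have hΨΦ := hpos'.isDualWith hpos (hrange'.trans hrange.symm) hΨcycle hΦcycle hscale
    (realMatrix_wordMatrix_mul_matrix_ne e o)
  have hΦΨ := hpos.isDualWith hpos' (hrange.trans hrange'.symm) hΦcycle hΨcycle hscale'
    (realMatrix_inv_ne_dirMatrix e o)
  exact ⟨⟨_, _, _, hΦΨ⟩, ⟨_, _, _, hΨΦ⟩, hΨΦ, hΦΨ⟩
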